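/- **Setting.** Manifolds and fields are smooth. Let $\mathcal N$ be an $\mathfrak n$-dimensional manifold and $(\mathcal M,g)$ an $(\mathfrak n+1)$-dimensional Lorentzian manifold of signature $(-,+,\dots,+)$ with Levi-Civita connection $\nabla$. Brackets around two indices denote symmetrization, $T_{(ab)}=\tfrac12(T_{ab}+T_{ba})$. *Null hypersurface data* $\{\mathcal N,\gamma,\ell,\ell^{(2)},Y\}$ consist of a symmetric $(0,2)$-tensor $\gamma$ of signature $(0,+,\dots,+)$, a covector $\ell$, a function $\ell^{(2)}$ and a symmetric $(0,2)$-tensor $Y$ on $\mathcal N$ such that at every $q\in\mathcal N$ the symmetric bilinear form $$\mathcal A((V,a),(Z,b))=\gamma(V,Z)+a\,\ell(Z)+b\,\ell(V)+ab\,\ell^{(2)}$$ on $T_q\mathcal N\times\mathbb R$ is nondegenerate. The vector field $n$ on $\mathcal N$ is the tangential part of the vector of $T_q\mathcal N\times\mathbb R$ that is $\mathcal A$-dual to the covector $(V,a)\mapsto a$; equivalently, $\gamma(n,\cdot)=0$ and $\ell(n)=1$. Put $U=\tfrac12\pounds_n\gamma$ and $F=\tfrac12 d\ell$, and let $\overset{\circ}{\nabla}$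 be the unique torsion-free connection on $\mathcal N$ with $$\overset{\circ}{\nabla}_a\gamma_{bc}=-\ell_bU_{ac}-\ell_cU_{ab},\qquad \overset{\circ}{\nabla}_a\ell_b=F_{ab}-\ell^{(2)}U_{ab}.$$ The data are *$\{\phi,\zeta\}$-embedded* in $(\mathcal M,g)$ if $\phi:\mathcal N\to\mathcal M$ is an embedding and $\zeta$ (the rigging) is a vector field along $\phi(\mathcal N)$, everywhere transverse to $\phi(\mathcal N)$, with $$\phi^\star g=\gamma,\quad \phi^\star(g(\zeta,\cdot))=\ell,\quad \phi^\star(g(\zeta,\zeta))=\ell^{(2)},\quad \tfrac12\phi^\star(\pounds_\zeta g)=Y.$$ (For a $(0,2)$-tensor $T$ on $\mathcal M$, $\phi^\star(\pounds_\zeta T)$ is computed with any local extension of $\zeta$ off $\phi(\mathcal N)$; it does not depend on the extension.) **Lemma.** Let $\{\mathcal N,\gamma,\ell,\ell^{(2)},Y\}$ be null hypersurface data $\{\phi,\zeta\}$-embedded in $(\mathcal M,g)$. Let $\eta$ be a vector field on a neighbourhood of $\phi(\mathcal N)$ which at $\phi(\mathcal N)$ is null (i.e. $g(\eta,\eta)=0$,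 zeros being allowed) and tangent to $\phi(\mathcal N)$. Put $\mathcal K=\pounds_\eta g$, let $\Sigma=\pounds_\eta\nabla$, i.e. $$\Sigma(X,Z)=[\eta,\nabla_XZ]-\nabla_{[\eta,X]}Z-\nabla_X[\eta,Z],$$ and define $$\mathfrak p=\phi^\star(\mathcal K(\zeta,\zeta)),\quad \mathfrak w=\phi^\star(\mathcal K(\zeta,\phi_\star n)),\quad \mathfrak q=\phi^\star(\mathcal K(\zeta,\cdot)),\quad \mathfrak I=\tfrac12\phi^\star(\pounds_\zeta\mathcal K),$$ $$\mathfrak B_{ab}=\overset{\circ}{\nabla}_{(a}\mathfrak q_{b)}+\mathfrak w\,Y_{ab}+\mathfrak p\,U_{ab}-\mathfrak I_{ab}.$$ Then there is a smooth function $\alpha$ on $\mathcal N$ with $\eta|_{\phi(\mathcal N)}=\alpha\,\phi_\star n$. Every smooth vector field $W$ along $\phi(\mathcal N)$ (not necessarily tangent) can be written as $W=\beta\zeta+\phi_\star\overline W$ with a smooth function $\beta$ and a smooth vector field $\overline W$ on $\mathcal N$. Moreover, for any vector field $W$ along $\phi(\mathcal N)$ decomposed as $W=\beta\zeta+\phi_\star\overline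 W$, $$\phi^\star\big(g(W,\Sigma)\big)_{ab}=\beta\,\mathfrak B_{ab}+\overline W{}^c\Big(2(\overset{\circ}{\nabla}_{(a}\alpha)U_{b)c}+U_{ab}\big(\mathfrak q_c-\overset{\circ}{\nabla}_c\alpha\big)+\alpha\big(2\overset{\circ}{\nabla}_{(a}U_{b)c}-\overset{\circ}{\nabla}_cU_{ab}\big)\Big).$$ -/

import Mathlib

open scoped Manifold ContDiff Topology
open VectorField

set_option linter.unusedSectionVars false

noncomputable section

namespace NullHypersurface

section TensorCalculus

variable {E : Type*} [NormedAddCommGroup E] [NormedSpace ℝ E]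
  {H : Type*} [TopologicalSpace H] {I : ModelWithCorners ℝ E H}
  {M : Type*} [TopologicalSpace M] [ChartedSpace H M]

section LieDerivatives

variable [IsManifold I 1 M]

/-- The vector field `X` is differentiable at `x`. -/
def VFDiffAt (X : Π x : M, TangentSpace I x) (x : M) : Prop :=
  MDifferentiableAt I I.tangent (fun y => (⟨y, X y⟩ : TangentBundle I M)) x

/-- The Lie derivative `£_X T` of a `(0,2)`-tensor field,
`(£_X T)(Y, Z) = X (T(Y, Z)) - T([X, Y], Z) - T(Y, [X, Z])`,
evaluated at the vectors `u`, `v` at `x` by means of their canonical local extensions to vector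
fields (constant in the preferred trivialization at `x`). -/
def lieDeriv₂ (X : Π x : M, TangentSpace I x)
    (T : Π x : M, TangentSpace I x → TangentSpace I x → ℝ) (x : M)
    (u v : TangentSpace I x) : ℝ :=
  mvfderiv I (fun y => T y (FiberBundle.extend E u y) (FiberBundle.extend E v y)) x (X x)
    - T x (mlieBracket I X (FiberBundle.extend E u) x) v
    - T x u (mlieBracket I X (FiberBundle.extend E v) x)

/-- The exterior derivative of a one-form,
`da(Y, Z) = Y (a(Z)) - Z (a(Y)) - a([Y, Z])`,
evaluated at the vectors `u`, `v` at `x` by means of their canonical local extensions. -/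
def extDeriv₁ (a : Π x : M, TangentSpace I x → ℝ) (x : M) (u v : TangentSpace I x) : ℝ :=
  mvfderiv I (fun y => a y (FiberBundle.extend E v y)) x u
    - mvfderiv I (fun y => a y (FiberBundle.extend E u y)) x v
    - a x (mlieBracket I (FiberBundle.extend E u) (FiberBundle.extend E v) x)

/-- The covariant derivative of a one-form: `covDeriv₁ nab a x u v = (∇_u a)(v)`. -/
def covDeriv₁ (nab : CovariantDerivative I E (TangentSpace I : M → Type _))
    (a : Π x : M, TangentSpace I x → ℝ) (x : M) (u v : TangentSpace I x) : ℝ :=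
  mvfderiv I (fun y => a y (FiberBundle.extend E v y)) x u
    - a x (nab (FiberBundle.extend E v) x u)

/-- The covariant derivative of a `(0,2)`-tensor field:
`covDeriv₂ nab T x u v w = (∇_u T)(v, w)`. -/
def covDeriv₂ (nab : CovariantDerivative I E (TangentSpace I : M → Type _))
    (T : Π x : M, TangentSpace I x → TangentSpace I x → ℝ) (x : M)
    (u v w : TangentSpace I x) : ℝ :=
  mvfderiv I (fun y => T y (FiberBundle.extend E v y) (FiberBundle.extend E w y)) x u
    - T x (nab (FiberBundle.extend E v) x u) w
    - T x v (nab (FiberBundle.extend E w) x u)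

/-- The Lie derivative `Σ = £_η ∇` of a connection `∇` along `η`, evaluated on vector fields:
`Σ(X, W) = £_η (∇_X W) - ∇_X (£_η W) - ∇_{£_η X} W`. -/
def lieDerivConnection (η : Π x : M, TangentSpace I x)
    (nab : CovariantDerivative I E (TangentSpace I : M → Type _))
    (X W : Π x : M, TangentSpace I x) (x : M) : TangentSpace I x :=
  mlieBracket I η (fun y => nab W y (X y)) x - nab (mlieBracket I η W) x (X x)
    - nab W x (mlieBracket I η X x)

end LieDerivatives

variable [FiniteDimensional ℝ E] [CompleteSpace E] [IsManifold I ∞ M]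

/-- The `(0,2)`-tensor field `G` is smooth. -/
def SmoothTensor₂ (G : Π x : M, TangentSpace I x →L[ℝ] TangentSpace I x →L[ℝ] ℝ) : Prop :=
  ContMDiff I (I.prod 𝓘(ℝ, E →L[ℝ] E →L[ℝ] ℝ)) ∞
    (fun x => Bundle.TotalSpace.mk' (E →L[ℝ] E →L[ℝ] ℝ)
      (E := fun x : M => TangentSpace I x →L[ℝ] TangentSpace I x →L[ℝ] ℝ) x (G x))

/-- The one-form `a` is smooth. -/
def SmoothTensor₁ (a : Π x : M, TangentSpace I x →L[ℝ] ℝ) : Prop :=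
  ContMDiff I (I.prod 𝓘(ℝ, E →L[ℝ] ℝ)) ∞
    (fun x => Bundle.TotalSpace.mk' (E →L[ℝ] ℝ)
      (E := fun x : M => TangentSpace I x →L[ℝ] ℝ) x (a x))

theorem SmoothTensor₂.mdiffAt {G : Π x : M, TangentSpace I x →L[ℝ] TangentSpace I x →L[ℝ] ℝ}
    (hG : SmoothTensor₂ G) {X Y : Π x : M, TangentSpace I x} {x : M}
    (hX : VFDiffAt X x) (hY : VFDiffAt Y x) :
    MDifferentiableAt I 𝓘(ℝ) (fun y => G y (X y) (Y y)) x := by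
  have h1 : MDifferentiableAt I (I.prod 𝓘(ℝ, E →L[ℝ] E →L[ℝ] ℝ)) 
      (fun x => Bundle.TotalSpace.mk' (E →L[ℝ] E →L[ℝ] ℝ)
      (E := fun x : M => TangentSpace I x →L[ℝ] TangentSpace I x →L[ℝ] ℝ) x (G x)) x :=
    (hG x).mdifferentiableAt (by simp)
  have : MDifferentiableAt I (I.prod 𝓘(ℝ)) 
      (fun m ↦ Bundle.TotalSpace.mk' ℝ (E := Bundle.Trivial M ℝ) m (G m (X m) (Y m))) x := by
    apply MDifferentiableAt.clm_bundle_apply₂ (F₁ := E) (F₂ := E)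
    · exact h1
    · exact hX
    · exact hY
  rw [mdifferentiableAt_totalSpace] at this
  exact this.2

theorem SmoothTensor₁.mdiffAt {a : Π x : M, TangentSpace I x →L[ℝ] ℝ}
    (ha : SmoothTensor₁ a) {X : Π x : M, TangentSpace I x} {x : M}
    (hX : VFDiffAt X x) :
    MDifferentiableAt I 𝓘(ℝ) (fun y => a y (X y)) x := by
  have h1 : MDifferentiableAt I (I.prod 𝓘(ℝ, E →L[ℝ] ℝ)) 
      (fun x => Bundle.TotalSpace.mk' (E →L[ℝ] ℝ)
      (E := fun x : M => TangentSpace I x →L[ℝ] ℝ) x (a x)) x :=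
    (ha x).mdifferentiableAt (by simp)
  have : MDifferentiableAt I (I.prod 𝓘(ℝ)) 
      (fun m ↦ Bundle.TotalSpace.mk' ℝ (E := Bundle.Trivial M ℝ) m (a m (X m))) x := by
    apply MDifferentiableAt.clm_bundle_apply (F₁ := E) 
    · exact h1
    · exact hX
  rw [mdifferentiableAt_totalSpace] at this
  exact this.2

/-- The right-hand side of the Koszul formula for the symmetric tensor `G`. -/
def koszul (G : Π x : M, TangentSpace I x →L[ℝ] TangentSpace I x →L[ℝ] ℝ)
    (X W Z : Π x : M, TangentSpace I x) (x : M) : ℝ :=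
  (1 / 2) * (mvfderiv I (fun y => G y (W y) (Z y)) x (X x)
    + mvfderiv I (fun y => G y (X y) (Z y)) x (W x)
    - mvfderiv I (fun y => G y (X y) (W y)) x (Z x)
    + G x (mlieBracket I X W x) (Z x) - G x (mlieBracket I X Z x) (W x)
    - G x (mlieBracket I W Z x) (X x))

variable {G : Π x : M, TangentSpace I x →L[ℝ] TangentSpace I x →L[ℝ] ℝ} 

theorem koszul_tensorial_left (hG : SmoothTensor₂ G)
    {W Z : Π x : M, TangentSpace I x} {x : M} (hW : VFDiffAt W x) (hZ : VFDiffAt Z x) :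
    TensorialAt I E (fun X => koszul G X W Z x) x where
  smul {f X} hf hX := by
    have hXZ := hG.mdiffAt hX hZ
    have hXW := hG.mdiffAt hX hW
    simp [koszul, mlieBracket_smul_left hf hX, mvfderiv_fun_mul hf hXZ, mvfderiv_fun_mul hf hXW]
    ring
  add {X X'} hX hX' := by
    have hXZ := hG.mdiffAt hX hZ
    have hXW := hG.mdiffAt hX hW
    have hXZ' := hG.mdiffAt hX' hZ
    have hXW' := hG.mdiffAt hX' hW
    simp [koszul, mlieBracket_add_left hX hX', mvfderiv_fun_add hXZ hXZ', mvfderiv_fun_add hXW hXW']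
    ring

theorem koszul_tensorial_right (hG : SmoothTensor₂ G) (hs : ∀ x u v, G x u v = G x v u)
    {X W : Π x : M, TangentSpace I x} {x : M} (hX : VFDiffAt X x) (hW : VFDiffAt W x) :
    TensorialAt I E (fun Z => koszul G X W Z x) x where
  smul {f Z} hf hZ := by
    have hXZ := hG.mdiffAt hX hZ
    have hWZ := hG.mdiffAt hW hZ
    simp [koszul, mlieBracket_smul_right hf hZ, mvfderiv_fun_mul hf hXZ, mvfderiv_fun_mul hf hWZ]
    rw [hs x (W x) (Z x), hs x (X x) (Z x)]
    ring
  add {Z Z'} hZ hZ' := by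
    have hXZ := hG.mdiffAt hX hZ
    have hWZ := hG.mdiffAt hW hZ
    have hXZ' := hG.mdiffAt hX hZ'
    have hWZ' := hG.mdiffAt hW hZ'
    simp [koszul, mlieBracket_add_right hZ hZ', mvfderiv_fun_add hXZ hXZ', mvfderiv_fun_add hWZ hWZ']
    ring

open Classical in
/-- The Koszul expression is tensorial in its first and third arguments. -/
def koszulHom (hG : SmoothTensor₂ G) (hs : ∀ x u v, G x u v = G x v u)
    (W : Π x : M, TangentSpace I x) (x : M) :
    TangentSpace I x →L[ℝ] TangentSpace I x →L[ℝ] ℝ :=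
  if hW : VFDiffAt W x then
    TensorialAt.mkHom₂ (I := I) (F := E) (F' := E) (fun X Z => koszul G X W Z x) x
      (fun _ hZ => koszul_tensorial_left hG hW hZ)
      (fun _ hX => koszul_tensorial_right hG hs hX hW)
  else 0

theorem koszulHom_apply (hG : SmoothTensor₂ G) (hs : ∀ x u v, G x u v = G x v u)
    {X W Z : Π x : M, TangentSpace I x} {x : M} (hX : VFDiffAt X x) (hW : VFDiffAt W x)
    (hZ : VFDiffAt Z x) : koszulHom hG hs W x (X x) (Z x) = koszul G X W Z x := by
  rw [koszulHom, dif_pos hW]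
  exact TensorialAt.mkHom₂_apply _ _ hX hZ

theorem vfdiffAt_extend {x : M} (u : TangentSpace I x) : VFDiffAt (FiberBundle.extend E u) x :=
  FiberBundle.mdifferentiableAt_extend ..

theorem VFDiffAt.add {X Y : Π x : M, TangentSpace I x} {x : M} (hX : VFDiffAt X x)
    (hY : VFDiffAt Y x) : VFDiffAt (X + Y) x := mdifferentiableAt_add_section hX hY

theorem VFDiffAt.smul {f : M → ℝ} {X : Π x : M, TangentSpace I x} {x : M}
    (hf : MDifferentiableAt I 𝓘(ℝ) f x) (hX : VFDiffAt X x) :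
    VFDiffAt (f • X) x := hf.smul_section hX

theorem koszulHom_add (hG : SmoothTensor₂ G) (hs : ∀ x u v, G x u v = G x v u)
    {W W' : Π x : M, TangentSpace I x} {x : M} (hW : VFDiffAt W x) (hW' : VFDiffAt W' x)
    (u v : TangentSpace I x) :
    koszulHom hG hs (W + W') x u v = koszulHom hG hs W x u v + koszulHom hG hs W' x u v := by
  have hX := vfdiffAt_extend u
  have hZ := vfdiffAt_extend v
  have e1 := koszulHom_apply hG hs hX hW hZ
  have e2 := koszulHom_apply hG hs hX hW' hZ
  have e3 := koszulHom_apply hG hs hX (hW.add hW') hZ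
  simp only [FiberBundle.extend_apply_self] at e1 e2 e3
  rw [e1, e2, e3]
  have h1 := hG.mdiffAt hX hW
  have h2 := hG.mdiffAt hX hW'
  have h3 := hG.mdiffAt hW hZ
  have h4 := hG.mdiffAt hW' hZ
  simp [koszul, mlieBracket_add_right hW hW', mlieBracket_add_left hW hW',
    mvfderiv_fun_add h1 h2, mvfderiv_fun_add h3 h4]
  ring

theorem koszulHom_smul (hG : SmoothTensor₂ G) (hs : ∀ x u v, G x u v = G x v u)
    {f : M → ℝ} {W : Π x : M, TangentSpace I x} {x : M}
    (hf : MDifferentiableAt I 𝓘(ℝ) f x) (hW : VFDiffAt W x)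
    (u v : TangentSpace I x) :
    koszulHom hG hs (f • W) x u v
      = f x * koszulHom hG hs W x u v + mvfderiv I f x u * G x (W x) v := by
  have hX := vfdiffAt_extend u
  have hZ := vfdiffAt_extend v
  have e1 := koszulHom_apply hG hs hX hW hZ
  have e3 := koszulHom_apply hG hs hX (hW.smul hf) hZ
  simp only [FiberBundle.extend_apply_self] at e1 e3
  rw [e1, e3]
  have h1 := hG.mdiffAt hX hW
  have h3 := hG.mdiffAt hW hZ
  simp [koszul, mlieBracket_smul_right hf hW, mlieBracket_smul_left hf hW,
    mvfderiv_fun_mul hf h1, mvfderiv_fun_mul hf h3]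
  rw [hs x u (W x)]
  ring

theorem koszul_antisymm (hs : ∀ x u v, G x u v = G x v u)
    (X W Z : Π x : M, TangentSpace I x) (x : M) :
    koszul G X W Z x - koszul G W X Z x = G x (mlieBracket I X W x) (Z x) := by
  have h : (fun y => G y (W y) (X y)) = (fun y => G y (X y) (W y)) := by
    funext y; exact hs _ _ _
  rw [koszul, koszul, h, mlieBracket_swap_apply (V := W) (W := X)]
  simp
  ring

theorem koszul_symm (hs : ∀ x u v, G x u v = G x v u)
    (X W Z : Π x : M, TangentSpace I x) (x : M) :
    koszul G X W Z x + koszul G X Z W x = mvfderiv I (fun y => G y (W y) (Z y)) x (X x) := by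
  have h : (fun y => G y (Z y) (W y)) = (fun y => G y (W y) (Z y)) := by
    funext y; exact hs _ _ _
  rw [koszul, koszul, h, mlieBracket_swap_apply (V := W) (W := Z)]
  simp
  ring

/-- A solution `X` of `h(X, ·) = a`, with `h` smooth and nondegenerate and `a` smooth, is smooth. -/
theorem contMDiffAt_of_dual {h : Π x : M, TangentSpace I x →L[ℝ] TangentSpace I x →L[ℝ] ℝ}
    {a : Π x : M, TangentSpace I x →L[ℝ] ℝ} (hh : SmoothTensor₂ h) (ha : SmoothTensor₁ a)
    {X : Π x : M, TangentSpace I x} (x : M)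
    (hinj : ∀ u, (∀ v, h x u v = 0) → u = 0)
    (hX : ∀ y v, h y (X y) v = a y v) :
    ContMDiffAt I I.tangent ∞ (fun y => (⟨y, X y⟩ : TangentBundle I M)) x := by
  have h1 := ((contMDiffAt_hom_bundle _).1 (hh x)).2
  have h2 := ((contMDiffAt_hom_bundle _).1 (ha x)).2
  simp only at h1 h2
  set hc : M → (E →L[ℝ] E →L[ℝ] ℝ) := fun y =>
    ContinuousLinearMap.inCoordinates E (fun y : M => TangentSpace I y) (E →L[ℝ] ℝ)
      (fun y : M => TangentSpace I y →L[ℝ] ℝ) x y x y (h y) with hhc0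
  set ac : M → (E →L[ℝ] ℝ) := fun y =>
    ContinuousLinearMap.inCoordinates E (fun y : M => TangentSpace I y) ℝ
      (fun _ : M => ℝ) x y x y (a y) with hac0
  set t := trivializationAt E (fun y : M => TangentSpace I y) x with ht
  have happ : ∀ y ∈ t.baseSet, ∀ u v, hc y u v = h y (t.symm y u) (t.symm y v) := by
    intro y hy u v
    simp only [hhc0]
    erw [inCoordinates_apply_eq₂ hy hy (by simp)]
    simp [ht]
  have haapp : ∀ y ∈ t.baseSet, ∀ v, ac y v = a y (t.symm y v) := by
    intro y hy v
    simp only [hac0, ContinuousLinearMap.inCoordinates]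
    rw [← Bundle.Trivialization.symmL_apply (R := ℝ) _ hy]
    simp [ht]
  have hxb : x ∈ t.baseSet := FiberBundle.mem_baseSet_trivializationAt' x
  have hinv : (hc x).IsInvertible := by
    have hi : Function.Injective (hc x).toLinearMap := by
      rw [← LinearMap.ker_eq_bot, LinearMap.ker_eq_bot']
      intro u hu
      have h0 : t.symm x u = 0 := by
        apply hinj
        intro v
        have := happ x hxb u (t ⟨x, v⟩).2
        have hz : hc x u (t ⟨x, v⟩).2 = 0 := by
          have : hc x u = 0 := hu
          rw [this]; rfl
        rw [hz] at this
        simpa [hxb] using this.symm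
      have := t.apply_mk_symm hxb u
      rw [h0] at this
      have h3 : (t ⟨x, (0 : TangentSpace I x)⟩).2 = 0 := by
        have := (t.linearMapAt ℝ x).map_zero
        rwa [t.linearMapAt_apply, if_pos hxb] at this
      rw [this] at h3
      exact h3
    have hd : Module.finrank ℝ E = Module.finrank ℝ (E →L[ℝ] ℝ) := by
      rw [← LinearMap.toContinuousLinearMap.finrank_eq (R := ℝ) (M := E →ₗ[ℝ] ℝ)]
      exact (Subspace.dual_finrank_eq (K := ℝ) (V := E)).symm
    refine ⟨(LinearEquiv.ofInjectiveOfFinrankEq (hc x).toLinearMap hi hd).toContinuousLinearEquiv, ?_⟩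
    ext u v
    rfl
  have hnear : ∀ᶠ y in 𝓝 x, (hc y).IsInvertible := by
    obtain ⟨e, he⟩ := hinv
    have : {f : E →L[ℝ] E →L[ℝ] ℝ | f.IsInvertible} ∈ 𝓝 (hc x) := by
      rw [← he]; exact ContinuousLinearEquiv.nhds e
    exact h1.continuousAt this
  rw [show I.tangent = I.prod 𝓘(ℝ, E) from rfl]
  refine (Bundle.contMDiffAt_section (F := E) (E := fun y : M => TangentSpace I y) x).2 ?_
  have hsol : ContMDiffAt I 𝓘(ℝ, E) ∞ (fun y => (hc y).inverse (ac y)) x := by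
    have hi : ContMDiffAt I 𝓘(ℝ, (E →L[ℝ] ℝ) →L[ℝ] E) ∞ (fun y => (hc y).inverse) x :=
      (hinv.contDiffAt_map_inverse (n := ∞)).contMDiffAt.comp x h1
    exact hi.clm_apply h2
  refine hsol.congr_of_eventuallyEq ?_
  filter_upwards [hnear, t.open_baseSet.mem_nhds hxb] with y hy hyb
  have : hc y (t ⟨y, X y⟩).2 = ac y := by
    ext v
    rw [happ y hyb, haapp y hyb, ← hX y]
    congr 2
    simp [hyb]
  rw [← this]
  exact (ContinuousLinearMap.IsInvertible.inverse_apply_self hy _).symm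

theorem lieDeriv₂_apply (hG : SmoothTensor₂ G) 
    {X Y Z : Π x : M, TangentSpace I x} {x : M} (hY : VFDiffAt Y x) (hZ : VFDiffAt Z x) :
    lieDeriv₂ X (fun x u v => G x u v) x (Y x) (Z x)
      = mvfderiv I (fun y => G y (Y y) (Z y)) x (X x)
        - G x (mlieBracket I X Y x) (Z x) - G x (Y x) (mlieBracket I X Z x) := by
  let Φ : (Π x : M, TangentSpace I x) → (Π x : M, TangentSpace I x) → ℝ := fun Y Z =>
    mvfderiv I (fun y => G y (Y y) (Z y)) x (X x)
        - G x (mlieBracket I X Y x) (Z x) - G x (Y x) (mlieBracket I X Z x)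
  have t1 : ∀ Z, VFDiffAt Z x → TensorialAt I E (fun Y => Φ Y Z) x := fun Z hZ =>
    { smul := fun {f Y} hf hY => by
        simp [Φ, mlieBracket_smul_right hf hY, mvfderiv_fun_mul hf (hG.mdiffAt hY hZ)]
        ring
      add := fun {Y Y'} hY hY' => by
        simp [Φ, mlieBracket_add_right hY hY',
          mvfderiv_fun_add (hG.mdiffAt hY hZ) (hG.mdiffAt hY' hZ)]
        ring }
  have t2 : ∀ Y, VFDiffAt Y x → TensorialAt I E (Φ Y) x := fun Y hY =>
    { smul := fun {f Z} hf hZ => by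
        simp [Φ, mlieBracket_smul_right hf hZ, mvfderiv_fun_mul hf (hG.mdiffAt hY hZ)]
        ring
      add := fun {Z Z'} hZ hZ' => by
        simp [Φ, mlieBracket_add_right hZ hZ',
          mvfderiv_fun_add (hG.mdiffAt hY hZ) (hG.mdiffAt hY hZ')]
        ring }
  have := TensorialAt.pointwise₂ (Φ := Φ) t1 t2 (vfdiffAt_extend (Y x)) hY
    (vfdiffAt_extend (Z x)) hZ (by simp) (by simp)
  change _ = Φ Y Z
  rw [← this]
  simp [Φ, lieDeriv₂]

theorem extDeriv₁_apply {a : Π x : M, TangentSpace I x →L[ℝ] ℝ} (ha : SmoothTensor₁ a) 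
    {Y Z : Π x : M, TangentSpace I x} {x : M} (hY : VFDiffAt Y x) (hZ : VFDiffAt Z x) :
    extDeriv₁ (fun x u => a x u) x (Y x) (Z x)
      = mvfderiv I (fun y => a y (Z y)) x (Y x) - mvfderiv I (fun y => a y (Y y)) x (Z x)
        - a x (mlieBracket I Y Z x) := by
  let Φ : (Π x : M, TangentSpace I x) → (Π x : M, TangentSpace I x) → ℝ := fun Y Z =>
    mvfderiv I (fun y => a y (Z y)) x (Y x) - mvfderiv I (fun y => a y (Y y)) x (Z x)
        - a x (mlieBracket I Y Z x)
  have t1 : ∀ Z, VFDiffAt Z x → TensorialAt I E (fun Y => Φ Y Z) x := fun Z hZ =>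
    { smul := fun {f Y} hf hY => by
        simp [Φ, mlieBracket_smul_left hf hY, mvfderiv_fun_mul hf (ha.mdiffAt hY)]
        ring
      add := fun {Y Y'} hY hY' => by
        simp [Φ, mlieBracket_add_left hY hY', mvfderiv_fun_add (ha.mdiffAt hY) (ha.mdiffAt hY')]
        ring }
  have t2 : ∀ Y, VFDiffAt Y x → TensorialAt I E (Φ Y) x := fun Y hY =>
    { smul := fun {f Z} hf hZ => by
        simp [Φ, mlieBracket_smul_right hf hZ, mvfderiv_fun_mul hf (ha.mdiffAt hZ)]
        ring
      add := fun {Z Z'} hZ hZ' => by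
        simp [Φ, mlieBracket_add_right hZ hZ', mvfderiv_fun_add (ha.mdiffAt hZ) (ha.mdiffAt hZ')]
        ring }
  have := TensorialAt.pointwise₂ (Φ := Φ) t1 t2 (vfdiffAt_extend (Y x)) hY
    (vfdiffAt_extend (Z x)) hZ (by simp) (by simp)
  change _ = Φ Y Z
  rw [← this]
  simp [Φ, extDeriv₁]

instance finiteDimensional_tangentSpace (x : M) : FiniteDimensional ℝ (TangentSpace I x) :=
  inferInstanceAs (FiniteDimensional ℝ E)

instance t2Space_tangentSpace (x : M) : T2Space (TangentSpace I x) :=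
  inferInstanceAs (T2Space E)

variable (I M) in
/-- A smooth Lorentzian metric of signature `(-, +, ..., +)`: at every point there is a timelike
vector `t` such that the metric is positive definite on the orthogonal complement of `t`. -/
structure LorentzianMetric where
  val : Π x : M, TangentSpace I x →L[ℝ] TangentSpace I x →L[ℝ] ℝ
  smooth : SmoothTensor₂ val
  symm : ∀ x u v, val x u v = val x v u
  lorentzian : ∀ x, ∃ t, val x t t < 0 ∧ ∀ v, val x t v = 0 → v ≠ 0 → 0 < val x v v

/-- The symmetric form
`A((W, a), (Z, b)) = γ(W, Z) + a ℓ(Z) + b ℓ(W) + a b ℓ⁽²⁾` on `T_x N × ℝ`. -/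
def ambientForm (γ : Π x : M, TangentSpace I x →L[ℝ] TangentSpace I x →L[ℝ] ℝ)
    (ell : Π x : M, TangentSpace I x →L[ℝ] ℝ) (ell2 : M → ℝ) (x : M) :
    LinearMap.BilinForm ℝ (TangentSpace I x × ℝ) :=
  LinearMap.mk₂ ℝ
    (fun w z => γ x w.1 z.1 + w.2 * ell x z.1 + z.2 * ell x w.1 + w.2 * z.2 * ell2 x)
    (fun _ _ _ => by simp; ring) (fun _ _ _ => by simp; ring)
    (fun _ _ _ => by simp; ring) (fun _ _ _ => by simp; ring)

variable (I M) in
/-- Null metric hypersurface data `{N, γ, ℓ, ℓ⁽²⁾}`: `γ` is symmetric of signature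
`(0, +, ..., +)`, i.e. positive semidefinite with one-dimensional radical, and the form
`ambientForm` is nondegenerate at every point. -/
structure NullMetricData where
  γ : Π x : M, TangentSpace I x →L[ℝ] TangentSpace I x →L[ℝ] ℝ
  ell : Π x : M, TangentSpace I x →L[ℝ] ℝ
  ell2 : M → ℝ
  smooth_γ : SmoothTensor₂ γ
  smooth_ell : SmoothTensor₁ ell
  smooth_ell2 : ContMDiff I 𝓘(ℝ) ∞ ell2
  symm_γ : ∀ x u v, γ x u v = γ x v u
  nonneg_γ : ∀ x u, 0 ≤ γ x u u
  finrank_radical : ∀ x, Module.finrank ℝ (LinearMap.ker (γ x).toLinearMap) = 1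
  nondegenerate : ∀ x, (ambientForm γ ell ell2 x).Nondegenerate

/-- The vector field `n`: the tensor inverse to `A = ambientForm` splits as
`A⁻¹((α, a), (β, b)) = P(α, β) + a n(β) + b n(α)`, hence `n` is the tangential part of the
vector `A⁻¹((0, 1), ·)`. -/
def NullMetricData.n (D : NullMetricData I M) (x : M) : TangentSpace I x :=
  (((ambientForm D.γ D.ell D.ell2 x).toDual (D.nondegenerate x)).symm
    (LinearMap.snd ℝ (TangentSpace I x) ℝ)).1


/-- `nab` is the Levi-Civita connection of `g`: torsion-free and metric. -/
structure IsLeviCivita (g : LorentzianMetric I M)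
    (nab : CovariantDerivative I E (TangentSpace I : M → Type _)) : Prop where
  torsion_free : ∀ (x : M) (X Y : Π x : M, TangentSpace I x), VFDiffAt X x → VFDiffAt Y x →
    nab Y x (X x) - nab X x (Y x) = mlieBracket I X Y x
  metric : ∀ (x : M) (u : TangentSpace I x) (Y Z : Π x : M, TangentSpace I x),
    VFDiffAt Y x → VFDiffAt Z x →
    mvfderiv I (fun y => g.val y (Y y) (Z y)) x u
      = g.val x (nab Y x u) (Z x) + g.val x (Y x) (nab Z x u)

theorem LorentzianMetric.eq_zero (g : LorentzianMetric I M) (x : M) (u : TangentSpace I x)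
    (h : ∀ v, g.val x u v = 0) : u = 0 := by
  obtain ⟨t, ht, hp⟩ := g.lorentzian x
  by_contra hu
  have := hp u (by rw [g.symm]; exact h t) hu
  rw [h u] at this
  exact lt_irrefl _ this

/-- Lowering an index with `g`. -/
def LorentzianMetric.flat (g : LorentzianMetric I M) (x : M) :
    TangentSpace I x ≃ₗ[ℝ] (TangentSpace I x →L[ℝ] ℝ) :=
  LinearEquiv.ofInjectiveOfFinrankEq (g.val x).toLinearMap
    (by
      rw [← LinearMap.ker_eq_bot, LinearMap.ker_eq_bot']
      intro u hu
      refine g.eq_zero x u fun v => ?_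
      exact congrArg (fun f : TangentSpace I x →L[ℝ] ℝ => f v) hu)
    (by
      rw [← LinearMap.toContinuousLinearMap.finrank_eq (R := ℝ) (M := TangentSpace I x →ₗ[ℝ] ℝ)]
      exact (Subspace.dual_finrank_eq (K := ℝ) (V := TangentSpace I x)).symm)

theorem LorentzianMetric.val_flat_symm (g : LorentzianMetric I M) (x : M)
    (a : TangentSpace I x →L[ℝ] ℝ) (v : TangentSpace I x) :
    g.val x ((g.flat x).symm a) v = a v :=
  congrArg (fun f : TangentSpace I x →L[ℝ] ℝ => f v) ((g.flat x).apply_symm_apply a)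

theorem exists_isLeviCivita (g : LorentzianMetric I M) :
    ∃ nab : CovariantDerivative I E (TangentSpace I : M → Type _), IsLeviCivita g nab := by
  let c : (Π x : M, TangentSpace I x) → (Π x : M, TangentSpace I x →L[ℝ] TangentSpace I x) :=
    fun W x => LinearMap.toContinuousLinearMap
      ((g.flat x).symm.toLinearMap ∘ₗ (koszulHom g.smooth g.symm W x).toLinearMap)
  have hc : ∀ W x u v, g.val x (c W x u) v = koszulHom g.smooth g.symm W x u v :=
    fun W x u v => g.val_flat_symm x _ v
  have hext : ∀ x (u v : TangentSpace I x), (∀ w, g.val x u w = g.val x v w) → u = v := by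
    intro x u v h
    refine sub_eq_zero.1 (g.eq_zero x _ fun w => ?_)
    rw [map_sub, sub_apply, h w, sub_self]
  have hcov : IsCovariantDerivativeOn E c Set.univ :=
    { add := by
        intro W W' x hW hW' _
        ext u
        apply hext
        intro v
        simp only [add_apply, map_add, hc]
        exact koszulHom_add _ _ hW hW' u v
      leibniz := by
        intro W f x hW hf _
        ext u
        apply hext
        intro v
        simp only [add_apply, map_add, hc]
        rw [koszulHom_smul _ _ hf hW]
        simp [hc] }
  refine ⟨⟨c, hcov⟩, ?_, ?_⟩
  · intro x X Y hX hY
    apply hext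
    intro v
    have hZ := vfdiffAt_extend v
    change g.val x (c Y x (X x) - c X x (Y x)) v = _
    rw [map_sub, sub_apply, hc, hc]
    have e1 := koszulHom_apply g.smooth g.symm hX hY hZ
    have e2 := koszulHom_apply g.smooth g.symm hY hX hZ
    rw [FiberBundle.extend_apply_self] at e1 e2
    rw [e1, e2, koszul_antisymm g.symm, FiberBundle.extend_apply_self]
  · intro x u Y Z hY hZ
    have hX := vfdiffAt_extend u
    change _ = g.val x (c Y x u) (Z x) + g.val x (Y x) (c Z x u)
    rw [g.symm x (Y x), hc, hc]
    have e1 := koszulHom_apply g.smooth g.symm hX hY hZ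
    have e2 := koszulHom_apply g.smooth g.symm hX hZ hY
    have e3 := koszul_symm g.symm (FiberBundle.extend E u) Y Z x
    rw [FiberBundle.extend_apply_self] at e1 e2 e3
    rw [e1, e2, e3]

/-- The Levi-Civita connection of `g`. -/
def leviCivita (g : LorentzianMetric I M) :
    CovariantDerivative I E (TangentSpace I : M → Type _) :=
  Classical.choose (exists_isLeviCivita g)

namespace NullMetricData

variable (D : NullMetricData I M)

theorem eq_zero (x : M) (u : TangentSpace I x) (h : ∀ v, D.γ x u v = 0) (h' : D.ell x u = 0) :
    u = 0 := by
  have := (D.nondegenerate x).1 (u, 0) (fun z => by simp [ambientForm, h, h'])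
  exact congrArg Prod.fst this

theorem n_spec (x : M) : (∀ v, D.γ x (D.n x) v = 0) ∧ D.ell x (D.n x) = 1 := by
  let y := ((ambientForm D.γ D.ell D.ell2 x).toDual (D.nondegenerate x)).symm
    (LinearMap.snd ℝ (TangentSpace I x) ℝ)
  have hy : ∀ z, ambientForm D.γ D.ell D.ell2 x y z = z.2 := fun z =>
    LinearMap.BilinForm.apply_toDual_symm_apply (hB := D.nondegenerate x) _ _
  have hn : D.n x = y.1 := rfl
  have h1 : ∀ w, D.γ x y.1 w + y.2 * D.ell x w = 0 := fun w => by
    simpa [ambientForm] using hy (w, 0)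
  have h2 : D.ell x y.1 + y.2 * D.ell2 x = 1 := by
    simpa [ambientForm] using hy (0, 1)
  obtain ⟨⟨r, hr⟩, hr0, -⟩ := finrank_eq_one_iff'.1 (D.finrank_radical x)
  have hr1 : ∀ v, D.γ x r v = 0 := fun v =>
    congrArg (fun f : TangentSpace I x →L[ℝ] ℝ => f v) hr
  have hr2 : D.ell x r ≠ 0 := fun h => hr0 (Subtype.ext (D.eq_zero x r hr1 h))
  have h3 := h1 r
  rw [D.symm_γ, hr1, zero_add] at h3
  have h4 : y.2 = 0 := (mul_eq_zero.1 h3).resolve_right hr2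
  rw [hn]
  simp only [h4, zero_mul, add_zero] at h1 h2
  exact ⟨h1, h2⟩

theorem γ_n (x : M) (v : TangentSpace I x) : D.γ x v (D.n x) = 0 := by
  rw [D.symm_γ]; exact (D.n_spec x).1 v

/-- The auxiliary positive definite metric `γ + ℓ ⊗ ℓ`. -/
def aux (x : M) : TangentSpace I x →L[ℝ] TangentSpace I x →L[ℝ] ℝ :=
  D.γ x + (D.ell x).smulRight (D.ell x)

theorem aux_apply (x : M) (u v : TangentSpace I x) :
    D.aux x u v = D.γ x u v + D.ell x u * D.ell x v := by
  simp [aux]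

theorem aux_eq_zero (x : M) (u : TangentSpace I x) (h : ∀ v, D.aux x u v = 0) : u = 0 := by
  have h1 : D.ell x u = 0 := by
    have := h (D.n x)
    rwa [aux_apply, γ_n, (D.n_spec x).2, mul_one, zero_add] at this
  refine D.eq_zero x u (fun v => ?_) h1
  have := h v
  rwa [aux_apply, h1, zero_mul, add_zero] at this

theorem smooth_aux : SmoothTensor₂ D.aux := by
  have h1 : SmoothTensor₂ (fun x => (D.ell x).smulRight (D.ell x)) := by
    intro x
    have h2 := ((contMDiffAt_hom_bundle _).1 (D.smooth_ell x)).2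
    simp only at h2
    refine (contMDiffAt_hom_bundle _).2 ⟨contMDiffAt_id, ?_⟩
    have h3 : ContMDiffAt I 𝓘(ℝ, E →L[ℝ] E →L[ℝ] ℝ) ∞ (fun y =>
        (ContinuousLinearMap.smulRightL ℝ E (E →L[ℝ] ℝ)
          (ContinuousLinearMap.inCoordinates E (fun y : M => TangentSpace I y) ℝ
            (fun _ : M => ℝ) x y x y (D.ell y)))
          (ContinuousLinearMap.inCoordinates E (fun y : M => TangentSpace I y) ℝ
            (fun _ : M => ℝ) x y x y (D.ell y))) x :=
      ContMDiffAt.clm_apply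
        ((ContinuousLinearMap.contDiff _).contMDiff.contMDiffAt.comp x h2) h2
    refine h3.congr_of_eventuallyEq ?_
    have hxb : x ∈ (trivializationAt E (fun y : M => TangentSpace I y) x).baseSet :=
      FiberBundle.mem_baseSet_trivializationAt' x
    filter_upwards [(trivializationAt E (fun y : M => TangentSpace I y) x).open_baseSet.mem_nhds
      hxb] with y hy
    ext u v
    erw [inCoordinates_apply_eq₂ hy hy (by simp)]
    have haapp : ∀ v, ContinuousLinearMap.inCoordinates E (fun y : M => TangentSpace I y) ℝ
            (fun _ : M => ℝ) x y x y (D.ell y) v = D.ell y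
              ((trivializationAt E (fun y : M => TangentSpace I y) x).symm y v) := by
      intro v
      simp only [ContinuousLinearMap.inCoordinates]
      rw [← Bundle.Trivialization.symmL_apply (R := ℝ) _ hy]
      simp
    simp [haapp]
  intro x
  exact (D.smooth_γ x).add_section (h1 x)

theorem smooth_n (x : M) :
    ContMDiffAt I I.tangent ∞ (fun y => (⟨y, D.n y⟩ : TangentBundle I M)) x := by
  refine contMDiffAt_of_dual D.smooth_aux D.smooth_ell x (D.aux_eq_zero x) fun y v => ?_
  rw [aux_apply, (D.n_spec y).1, (D.n_spec y).2, zero_add, one_mul]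

theorem vfdiffAt_n (x : M) : VFDiffAt D.n x := (D.smooth_n x).mdifferentiableAt (by simp)

/-- `U = (1/2) £_n γ`. -/
def U (x : M) (u v : TangentSpace I x) : ℝ :=
  (1 / 2) * lieDeriv₂ D.n (fun x u v => D.γ x u v) x u v

/-- `F = (1/2) dℓ`. -/
def F (x : M) (u v : TangentSpace I x) : ℝ :=
  (1 / 2) * extDeriv₁ (fun x u => D.ell x u) x u v

/-- Auxiliary expression `X(ℓ(W)) - F(X, W)`. -/
def lamAux (X W : Π x : M, TangentSpace I x) (x : M) : ℝ :=
  (1 / 2) * (mvfderiv I (fun y => D.ell y (W y)) x (X x)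
    + mvfderiv I (fun y => D.ell y (X y)) x (W x) + D.ell x (mlieBracket I X W x))

theorem lamAux_tensorial {W : Π x : M, TangentSpace I x} {x : M} :
    TensorialAt I E (fun X => D.lamAux X W x) x where
  smul {f X} hf hX := by
    simp [lamAux, mlieBracket_smul_left hf hX, mvfderiv_fun_mul hf (D.smooth_ell.mdiffAt hX)]
    ring
  add {X X'} hX hX' := by
    simp [lamAux, mlieBracket_add_left hX hX',
      mvfderiv_fun_add (D.smooth_ell.mdiffAt hX) (D.smooth_ell.mdiffAt hX')]
    ring

/-- `lamAux` is tensorial in its first argument. -/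
def lam (W : Π x : M, TangentSpace I x) (x : M) : TangentSpace I x →L[ℝ] ℝ :=
  TensorialAt.mkHom (I := I) (F := E) (fun X => D.lamAux X W x) x D.lamAux_tensorial

theorem lam_apply (W : Π x : M, TangentSpace I x) {X : Π x : M, TangentSpace I x} {x : M}
    (hX : VFDiffAt X x) : D.lam W x (X x) = D.lamAux X W x :=
  TensorialAt.mkHom_apply _ hX

theorem lam_apply' (W : Π x : M, TangentSpace I x) {x : M} (u : TangentSpace I x) :
    D.lam W x u = D.lamAux (FiberBundle.extend E u) W x := rfl

theorem lam_add {W W' : Π x : M, TangentSpace I x} {x : M} (hW : VFDiffAt W x)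
    (hW' : VFDiffAt W' x) (u : TangentSpace I x) :
    D.lam (W + W') x u = D.lam W x u + D.lam W' x u := by
  simp [lam_apply', lamAux, mlieBracket_add_right hW hW',
      mvfderiv_fun_add (D.smooth_ell.mdiffAt hW) (D.smooth_ell.mdiffAt hW')]
  ring

theorem lam_smul {f : M → ℝ} {W : Π x : M, TangentSpace I x} {x : M}
    (hf : MDifferentiableAt I 𝓘(ℝ) f x) (hW : VFDiffAt W x) (u : TangentSpace I x) :
    D.lam (f • W) x u = f x * D.lam W x u + mvfderiv I f x u * D.ell x (W x) := by
  simp [lam_apply', lamAux, mlieBracket_smul_right hf hW,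
      mvfderiv_fun_mul hf (D.smooth_ell.mdiffAt hW)]
  ring

/-- Lowering an index with the auxiliary metric. -/
def lower (x : M) : TangentSpace I x ≃ₗ[ℝ] (TangentSpace I x →L[ℝ] ℝ) :=
  LinearEquiv.ofInjectiveOfFinrankEq (D.aux x).toLinearMap
    (by
      rw [← LinearMap.ker_eq_bot, LinearMap.ker_eq_bot']
      intro u hu
      refine D.aux_eq_zero x u fun v => ?_
      exact congrArg (fun f : TangentSpace I x →L[ℝ] ℝ => f v) hu)
    (by
      rw [← LinearMap.toContinuousLinearMap.finrank_eq (R := ℝ) (M := TangentSpace I x →ₗ[ℝ] ℝ)]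
      exact (Subspace.dual_finrank_eq (K := ℝ) (V := TangentSpace I x)).symm)

theorem aux_lower_symm (x : M) (a : TangentSpace I x →L[ℝ] ℝ) (v : TangentSpace I x) :
    D.aux x ((D.lower x).symm a) v = a v :=
  congrArg (fun f : TangentSpace I x →L[ℝ] ℝ => f v) ((D.lower x).apply_symm_apply a)

end NullMetricData

/-- `nab` is the metric hypersurface connection `∇°` of the data, the torsion-free connection
determined by
`(∇°_a γ)_{bc} = - ℓ_b U_{ac} - ℓ_c U_{ab}` and `(∇°_a ℓ)_b = F_{ab} - ℓ⁽²⁾ U_{ab}`. -/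
structure IsMetricHypersurfaceConnection (D : NullMetricData I M)
    (nab : CovariantDerivative I E (TangentSpace I : M → Type _)) : Prop where
  torsion_free : ∀ (x : M) (X Y : Π x : M, TangentSpace I x), VFDiffAt X x → VFDiffAt Y x →
    nab Y x (X x) - nab X x (Y x) = mlieBracket I X Y x
  deriv_γ : ∀ (x : M) (u : TangentSpace I x) (Y Z : Π x : M, TangentSpace I x),
    VFDiffAt Y x → VFDiffAt Z x →
    mvfderiv I (fun y => D.γ y (Y y) (Z y)) x u
        - D.γ x (nab Y x u) (Z x) - D.γ x (Y x) (nab Z x u)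
      = - D.ell x (Y x) * D.U x u (Z x) - D.ell x (Z x) * D.U x u (Y x)
  deriv_ell : ∀ (x : M) (u : TangentSpace I x) (Y : Π x : M, TangentSpace I x), VFDiffAt Y x →
    mvfderiv I (fun y => D.ell y (Y y)) x u - D.ell x (nab Y x u)
      = D.F x u (Y x) - D.ell2 x * D.U x u (Y x)

theorem exists_isMetricHypersurfaceConnection (D : NullMetricData I M) :
    ∃ nab : CovariantDerivative I E (TangentSpace I : M → Type _),
      IsMetricHypersurfaceConnection D nab := by
  let k := koszulHom D.smooth_γ D.symm_γ
  let c : (Π x : M, TangentSpace I x) → (Π x : M, TangentSpace I x →L[ℝ] TangentSpace I x) :=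
    fun W x => LinearMap.toContinuousLinearMap
      { toFun := fun u => (D.lower x).symm (k W x u
          + (D.lam W x u - (1 + D.ell2 x) * k W x u (D.n x)) • D.ell x)
        map_add' := fun u v => by
          rw [← map_add]
          congr 1
          ext w
          simp
          ring
        map_smul' := fun r u => by
          rw [← map_smul]
          congr 1
          ext w
          simp
          ring }
  have hc : ∀ W x u v, D.aux x (c W x u) v = k W x u v
          + (D.lam W x u - (1 + D.ell2 x) * k W x u (D.n x)) * D.ell x v :=
    fun W x u v => D.aux_lower_symm x _ v
  have hext : ∀ x (u v : TangentSpace I x), (∀ w, D.aux x u w = D.aux x v w) → u = v := by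
    intro x u v h
    refine sub_eq_zero.1 (D.aux_eq_zero x _ fun w => ?_)
    rw [map_sub, sub_apply, h w, sub_self]
  have hl : ∀ W x u, D.ell x (c W x u) = D.lam W x u - D.ell2 x * k W x u (D.n x) := by
    intro W x u
    have := hc W x u (D.n x)
    rw [D.aux_apply, D.γ_n, (D.n_spec x).2] at this
    linarith
  have hγ : ∀ W x u v, D.γ x (c W x u) v = k W x u v - k W x u (D.n x) * D.ell x v := by
    intro W x u v
    have := hc W x u v
    rw [D.aux_apply, hl] at this
    linarith
  have hcov : IsCovariantDerivativeOn E c Set.univ :=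
    { add := by
        intro W W' x hW hW' _
        ext u
        apply hext
        intro v
        simp only [add_apply, map_add, hc, k]
        rw [koszulHom_add _ _ hW hW', koszulHom_add _ _ hW hW', D.lam_add hW hW']
        ring
      leibniz := by
        intro W f x hW hf _
        ext u
        apply hext
        intro v
        simp only [add_apply, map_add, hc, k]
        rw [koszulHom_smul _ _ hf hW, koszulHom_smul _ _ hf hW, D.lam_smul hf hW]
        simp [hc, k, D.γ_n, D.aux_apply]
        ring }
  have hU : ∀ (W : Π x : M, TangentSpace I x) x (u : TangentSpace I x), VFDiffAt W x →
      k W x u (D.n x) = - D.U x u (W x) := by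
    intro W x u hW
    have hX := vfdiffAt_extend u
    have e1 := koszulHom_apply D.smooth_γ D.symm_γ hX hW (D.vfdiffAt_n x)
    have e2 := lieDeriv₂_apply D.smooth_γ (X := D.n) hX hW
    have z1 : (fun y => D.γ y (W y) (D.n y)) = fun _ => 0 := by
      funext y; exact D.γ_n y _
    have z2 : (fun y => D.γ y (FiberBundle.extend E u y) (D.n y)) = fun _ => 0 := by
      funext y; exact D.γ_n y _
    rw [koszul, z1, z2, mvfderiv_const, D.γ_n, mlieBracket_swap_apply (V := FiberBundle.extend E u),
      mlieBracket_swap_apply (V := W)] at e1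
    rw [D.symm_γ x _ (mlieBracket I D.n W x)] at e2
    rw [FiberBundle.extend_apply_self] at e1 e2
    simp only [k, NullMetricData.U]
    rw [e1, e2]
    simp
    ring
  refine ⟨⟨c, hcov⟩, ?_, ?_, ?_⟩
  · intro x X Y hX hY
    apply hext
    intro v
    have hZ := vfdiffAt_extend v
    change D.aux x (c Y x (X x) - c X x (Y x)) v = _
    rw [map_sub, sub_apply, hc, hc]
    have e1 := koszulHom_apply D.smooth_γ D.symm_γ hX hY hZ
    have e2 := koszulHom_apply D.smooth_γ D.symm_γ hY hX hZ
    have e3 := koszulHom_apply D.smooth_γ D.symm_γ hX hY (D.vfdiffAt_n x)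
    have e4 := koszulHom_apply D.smooth_γ D.symm_γ hY hX (D.vfdiffAt_n x)
    have e5 := koszul_antisymm D.symm_γ X Y (FiberBundle.extend E v) x
    have e6 := koszul_antisymm D.symm_γ X Y D.n x
    rw [D.γ_n] at e6
    rw [FiberBundle.extend_apply_self] at e1 e2 e5
    simp only [k]
    rw [e1, e2, e3, e4, D.aux_apply, D.lam_apply _ hX, D.lam_apply _ hY, ← e5,
      sub_eq_zero.1 e6]
    have e7 : D.lamAux X Y x - D.lamAux Y X x = D.ell x (mlieBracket I X Y x) := by
      rw [NullMetricData.lamAux, NullMetricData.lamAux, mlieBracket_swap_apply (V := Y) (W := X)]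
      simp
      ring
    rw [← e7]
    ring
  · intro x u Y Z hY hZ
    have hX := vfdiffAt_extend u
    change _ - D.γ x (c Y x u) (Z x) - D.γ x (Y x) (c Z x u) = _
    rw [D.symm_γ x (Y x), hγ, hγ, hU Y x u hY, hU Z x u hZ]
    have e1 := koszulHom_apply D.smooth_γ D.symm_γ hX hY hZ
    have e2 := koszulHom_apply D.smooth_γ D.symm_γ hX hZ hY
    have e3 := koszul_symm D.symm_γ (FiberBundle.extend E u) Y Z x
    rw [FiberBundle.extend_apply_self] at e1 e2 e3
    simp only [k]
    rw [e1, e2, ← e3]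
    ring
  · intro x u Y hY
    have hX := vfdiffAt_extend u
    change _ - D.ell x (c Y x u) = _
    have e := extDeriv₁_apply D.smooth_ell hX hY
    rw [FiberBundle.extend_apply_self] at e
    rw [hl, hU Y x u hY, D.lam_apply', NullMetricData.lamAux, NullMetricData.F, e,
      FiberBundle.extend_apply_self]
    ring

/-- The metric hypersurface connection `∇°` of the data. -/
def metricHypersurfaceConnection (D : NullMetricData I M) :
    CovariantDerivative I E (TangentSpace I : M → Type _) :=
  Classical.choose (exists_isMetricHypersurfaceConnection D)

variable (I M) in
/-- Null hypersurface data `{N, γ, ℓ, ℓ⁽²⁾, Y}`. -/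
structure NullHypersurfaceData extends NullMetricData I M where
  Y : Π x : M, TangentSpace I x →L[ℝ] TangentSpace I x →L[ℝ] ℝ
  smooth_Y : SmoothTensor₂ Y
  symm_Y : ∀ x u v, Y x u v = Y x v u

end TensorCalculus

section Embedded

variable {E : Type*} [NormedAddCommGroup E] [NormedSpace ℝ E]
  {H : Type*} [TopologicalSpace H] {I : ModelWithCorners ℝ E H}
  {M : Type*} [TopologicalSpace M] [ChartedSpace H M]
  {E' : Type*} [NormedAddCommGroup E'] [NormedSpace ℝ E']
  {H' : Type*} [TopologicalSpace H'] {J : ModelWithCorners ℝ E' H'}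
  {N : Type*} [TopologicalSpace N] [ChartedSpace H' N]
  [IsManifold I ∞ M] [IsManifold J ∞ N]

theorem exists_localRetraction [J.Boundaryless] {φ : N → M} {p : N}
    (hφ : Manifold.IsImmersionAt J I ∞ φ p) :
    ∃ r : M → N, ContMDiffAt I J ∞ r (φ p) ∧ ∀ᶠ q in 𝓝 p, r (φ q) = q := by
  obtain ⟨F, _, _, h⟩ := hφ
  have hsrc : ∀ᶠ q in 𝓝 p, q ∈ h.domChart.source :=
    h.domChart.open_source.mem_nhds h.mem_domChart_source
  have key : ∀ q ∈ h.domChart.source,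
      (h.equiv.symm (h.codChart.extend I (φ q))).1 = h.domChart.extend J q := by
    intro q hq
    have hq' : q ∈ (h.domChart.extend J).source := by rwa [h.domChart.extend_source]
    have := h.writtenInCharts ((h.domChart.extend J).map_source hq')
    simp only [Function.comp_apply, (h.domChart.extend J).left_inv hq'] at this
    rw [this]
    simp
  refine ⟨fun y => (h.domChart.extend J).symm (h.equiv.symm (h.codChart.extend I y)).1, ?_, ?_⟩
  · have h1 : ContMDiffAt I 𝓘(ℝ, E) ∞ (h.codChart.extend I) (φ p) :=
      I.contMDiff.contMDiffAt.comp (φ p)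
        (contMDiffAt_of_mem_maximalAtlas h.codChart_mem_maximalAtlas h.mem_codChart_source)
    have h2 : ContMDiffAt 𝓘(ℝ, E) 𝓘(ℝ, E') ∞ (fun z => (h.equiv.symm z).1)
        (h.codChart.extend I (φ p)) :=
      (contDiff_fst.comp h.equiv.symm.contDiff).contMDiff.contMDiffAt
    have h3 : ContMDiffAt 𝓘(ℝ, E') J ∞ (h.domChart.extend J).symm
        (h.equiv.symm (h.codChart.extend I (φ p))).1 := by
      refine (contMDiffOn_extend_symm h.domChart_mem_maximalAtlas).contMDiffAt ?_
      rw [key p h.mem_domChart_source]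
      refine (J.toHomeomorph.isOpenMap _ h.domChart.open_target).mem_nhds ?_
      exact ⟨_, h.domChart.map_source h.mem_domChart_source, rfl⟩
    exact h3.comp (φ p) (h2.comp (φ p) h1)
  · filter_upwards [hsrc] with q hq
    rw [key q hq]
    exact (h.domChart.extend J).left_inv (by rwa [h.domChart.extend_source])

variable (J) in
/-- `ζe` is a vector field near `φ p` which is smooth at `φ p` and extends, near `p`, the vector
field `ζ` along `φ`. -/
structure IsLocalExtension (φ : N → M) (ζ : Π q : N, TangentSpace I (φ q)) (p : N)
    (ζe : Π y : M, TangentSpace I y) : Prop where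
  smooth : ContMDiffAt I I.tangent ∞ (fun y => (⟨y, ζe y⟩ : TangentBundle I M)) (φ p)
  eq_along : ∀ᶠ q in 𝓝 p, ζe (φ q) = ζ q

theorem exists_isLocalExtension [J.Boundaryless] {φ : N → M} {p : N}
    (hφ : Manifold.IsImmersionAt J I ∞ φ p) {ζ : Π q : N, TangentSpace I (φ q)}
    (hζ : ContMDiffAt J I.tangent ∞ (fun q => (⟨φ q, ζ q⟩ : TangentBundle I M)) p) :
    ∃ ζe, IsLocalExtension φ ζ p ζe := by
  obtain ⟨r, hr, hrφ⟩ := exists_localRetraction hφ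
  have hr0 : r (φ p) = p := hrφ.self_of_nhds
  let t := trivializationAt E (fun y : M => TangentSpace I y) (φ p)
  have hb : φ p ∈ t.baseSet := FiberBundle.mem_baseSet_trivializationAt' (φ p)
  have hcoord : ContMDiffAt J 𝓘(ℝ, E) ∞
      (fun q => (t (⟨φ q, ζ q⟩ : TangentBundle I M)).2) p :=
    ((Bundle.contMDiffAt_totalSpace (F := E) (E := fun y : M => TangentSpace I y)
      (f := fun q => (⟨φ q, ζ q⟩ : TangentBundle I M))).1 hζ).2
  have hcont : ContinuousAt φ p :=
    ((Bundle.contMDiffAt_totalSpace (F := E) (E := fun y : M => TangentSpace I y)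
      (f := fun q => (⟨φ q, ζ q⟩ : TangentBundle I M))).1 hζ).1.continuousAt
  refine ⟨fun y => t.symm y (t (⟨φ (r y), ζ (r y)⟩ : TangentBundle I M)).2, ?_, ?_⟩
  · refine (Bundle.contMDiffAt_section (F := E) (E := fun y : M => TangentSpace I y) (φ p)).2 ?_
    have hcomp : ContMDiffAt I 𝓘(ℝ, E) ∞
        (fun y => (t (⟨φ (r y), ζ (r y)⟩ : TangentBundle I M)).2) (φ p) :=
      ContMDiffAt.comp_of_eq (g := fun q => (t (⟨φ q, ζ q⟩ : TangentBundle I M)).2)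
        hcoord hr hr0
    refine hcomp.congr_of_eventuallyEq ?_
    filter_upwards [t.open_baseSet.mem_nhds hb] with y hy
    have := t.apply_mk_symm hy (t (⟨φ (r y), ζ (r y)⟩ : TangentBundle I M)).2
    exact (congrArg Prod.snd this :)
  · filter_upwards [hrφ, hcont (t.open_baseSet.mem_nhds hb)] with q hq hqb
    have : (t (⟨φ (r (φ q)), ζ (r (φ q))⟩ : TangentBundle I M)).2
        = (t (⟨φ q, ζ q⟩ : TangentBundle I M)).2 := by rw [hq]
    rw [this]
    exact t.symm_apply_apply_mk hqb (ζ q)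

variable (I J) in
/-- A rigging: a smooth vector field along `φ`, everywhere transverse to `φ(N)`. -/
structure Rigging (φ : N → M) where
  field : Π q : N, TangentSpace I (φ q)
  smooth : ContMDiff J I.tangent ∞ (fun q => (⟨φ q, field q⟩ : TangentBundle I M))
  transverse : ∀ q, field q ∉ Set.range (mfderiv J I φ q)

variable [J.Boundaryless]

/-- A local extension of the rigging off `φ(N)` near `φ q`. -/
def localExtension {φ : N → M} (hφ : Manifold.IsSmoothEmbedding J I ∞ φ) (ζ : Rigging I J φ)
    (q : N) : Π y : M, TangentSpace I y :=
  Classical.choose (exists_isLocalExtension (hφ.isImmersion.isImmersionAt q) (ζ.smooth q))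

/-- The pull-back `φ^*(£_ζ T)` for a `(0,2)`-tensor field `T` on `M`. Only derivatives of the
rigging `ζ` in directions tangent to `φ(N)` enter, so the choice of the local extension of `ζ` off
`φ(N)` is immaterial. -/
def pullbackLieRigging {φ : N → M} (hφ : Manifold.IsSmoothEmbedding J I ∞ φ) (ζ : Rigging I J φ)
    (T : Π y : M, TangentSpace I y → TangentSpace I y → ℝ) (q : N) (u v : TangentSpace J q) : ℝ :=
  lieDeriv₂ (localExtension hφ ζ q) T (φ q) (mfderiv J I φ q u) (mfderiv J I φ q v)

variable [FiniteDimensional ℝ E] [CompleteSpace E] [FiniteDimensional ℝ E'] [CompleteSpace E']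

/-- The null hypersurface data `D` are embedded in `(M, g)` with embedding `φ` and rigging `ζ`. -/
structure NullHypersurfaceData.IsEmbedded (D : NullHypersurfaceData J N) (g : LorentzianMetric I M)
    {φ : N → M} (hφ : Manifold.IsSmoothEmbedding J I ∞ φ) (ζ : Rigging I J φ) : Prop where
  γ_eq : ∀ q u v, g.val (φ q) (mfderiv J I φ q u) (mfderiv J I φ q v) = D.γ q u v
  ell_eq : ∀ q u, g.val (φ q) (ζ.field q) (mfderiv J I φ q u) = D.ell q u
  ell2_eq : ∀ q, g.val (φ q) (ζ.field q) (ζ.field q) = D.ell2 q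
  Y_eq : ∀ q u v, (1 / 2) * pullbackLieRigging hφ ζ (fun y u v => g.val y u v) q u v = D.Y q u v

/-- The deformation tensor `K = £_η g`. -/
def deformationTensor (g : LorentzianMetric I M) (η : Π y : M, TangentSpace I y) (y : M)
    (u v : TangentSpace I y) : ℝ :=
  lieDeriv₂ η (fun y u v => g.val y u v) y u v

/-- The scalar `p = φ^*(K(ζ, ζ))`. -/
def pScalar {φ : N → M} (ζ : Rigging I J φ) (g : LorentzianMetric I M)
    (η : Π y : M, TangentSpace I y) (q : N) : ℝ :=
  deformationTensor g η (φ q) (ζ.field q) (ζ.field q)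

/-- The scalar `w = φ^*(K(ζ, ν))`, where `ν = φ_* n` is the null normal of `φ(N)` with
`g(ν, ζ) = 1`. -/
def wScalar (D : NullMetricData J N) {φ : N → M} (ζ : Rigging I J φ) (g : LorentzianMetric I M)
    (η : Π y : M, TangentSpace I y) (q : N) : ℝ :=
  deformationTensor g η (φ q) (ζ.field q) (mfderiv J I φ q (D.n q))

/-- The covector `q = φ^*(K(ζ, ·))`. -/
def qCovector {φ : N → M} (ζ : Rigging I J φ) (g : LorentzianMetric I M)
    (η : Π y : M, TangentSpace I y) (q : N) (u : TangentSpace J q) : ℝ :=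
  deformationTensor g η (φ q) (ζ.field q) (mfderiv J I φ q u)

/-- The tensor `𝕴 = (1/2) φ^*(£_ζ K)`. -/
def iTensor {φ : N → M} (hφ : Manifold.IsSmoothEmbedding J I ∞ φ) (ζ : Rigging I J φ)
    (g : LorentzianMetric I M) (η : Π y : M, TangentSpace I y) (q : N)
    (u v : TangentSpace J q) : ℝ :=
  (1 / 2) * pullbackLieRigging hφ ζ (deformationTensor g η) q u v

/-- The tensor `𝔅_{ab} = ∇°_{(a} q_{b)} + w Y_{ab} + p U_{ab} - 𝕴_{ab}`. -/
def bTensor (D : NullHypersurfaceData J N) {φ : N → M} (hφ : Manifold.IsSmoothEmbedding J I ∞ φ)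
    (ζ : Rigging I J φ) (g : LorentzianMetric I M) (η : Π y : M, TangentSpace I y) (q : N)
    (u v : TangentSpace J q) : ℝ :=
  (1 / 2) * (covDeriv₁ (metricHypersurfaceConnection D.toNullMetricData) (qCovector ζ g η) q u v
      + covDeriv₁ (metricHypersurfaceConnection D.toNullMetricData) (qCovector ζ g η) q v u)
    + wScalar D.toNullMetricData ζ g η q * D.Y q u v
    + pScalar ζ g η q * D.U q u v
    - iTensor hφ ζ g η q u v

end Embedded

end NullHypersurface

end

open NullHypersurface

noncomputable section

namespace NullHypersurface

/-! ### Smooth vector fields, Lie brackets as commutators, and related vector fields. -/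

section SmoothCalculus

/-! The starting point is an ambient identity. Differentiating `K(Z,W) = η(g(Z,W)) - g([η,Z],W) -
g(Z,[η,W])` along `X`, and using metricity and the commutator of `η` and `X` acting on functions,
gives `(∇_X K)(Z,W) = g(Σ(X,Z),W) + g(Z,Σ(X,W))` (`IsLeviCivita.covExpr_lieTensor`). Vanishing
torsion and the Jacobi identity make `Σ` symmetric, so the permutation trick behind the Christoffel
symbols yields `2 g(W,Σ(X,Z)) = (∇_X K)(Z,W) + (∇_Z K)(X,W) - (∇_W K)(X,Z)`
(`IsLeviCivita.two_mul_val_lieDerivConnection`). Its right side depends only on the values of `X`,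
`Z`, `W` at the point, so it remains to evaluate it for `X`, `Z` tangent to the hypersurface and for
`W` either tangent or equal to the rigging; linearity in `W` does the rest.

The bridge to the intrinsic connection is the Gauss-type formula `∇_X Z = ∇°_X Z - Y(X,Z) n - U(X,Z)
ζ` (`NullHypersurfaceData.IsEmbedded.gauss`). It follows from the Koszul formula, contracted with
tangent vectors and with `ζ`.

Since `γ` is semidefinite with radical spanned by `n`, a null tangent `η` equals `α n` along the
hypersurface. Hence `K` restricted to tangent vectors is `£_{αn} γ = 2αU`, while `K(ζ,·)` is the
covector `q`. For tangent `W`, Gauss turns each derivative of `K` into `2∇°(αU)` plus products of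
`U` and `q` (the `Y` terms drop out because `U(n,·) = 0`), and in the alternating sum only `2U(X,Z)
q(W)` survives among these products (`IsNullTangent.val_tangent`).

For `W = ζ` the transverse derivative `∇_ζ K` is exchanged for `£_ζ K = 2𝕴` at the price of terms
`K(∇_X ζ, Z)` and `K(X, ∇_Z ζ)`. These cancel exactly against the derivatives of the rigging in the
other two terms, leaving the tensor `𝔅` (`IsNullTangent.val_rigging`). -/

theorem natCast_le_infty (k : ℕ) : (k : WithTop ℕ∞) ≤ ∞ := by
  exact_mod_cast (le_top : (k : ℕ∞) ≤ ⊤)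

theorem two_le_infty : (2 : WithTop ℕ∞) ≤ ∞ := natCast_le_infty 2

theorem three_le_infty : (3 : WithTop ℕ∞) ≤ ∞ := natCast_le_infty 3

variable {E : Type*} [NormedAddCommGroup E] [NormedSpace ℝ E]
  {H : Type*} [TopologicalSpace H] {I : ModelWithCorners ℝ E H}
  {M : Type*} [TopologicalSpace M] [ChartedSpace H M]

section

variable [IsManifold I ∞ M]

/-- The vector field `X` is smooth at `x`. -/
def VFSmoothAt (X : Π x : M, TangentSpace I x) (x : M) : Prop :=
  ContMDiffAt I I.tangent ∞ (fun y => (⟨y, X y⟩ : TangentBundle I M)) x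

theorem VFSmoothAt.vfdiffAt {X : Π x : M, TangentSpace I x} {x : M} (hX : VFSmoothAt X x) :
    VFDiffAt X x :=
  ContMDiffAt.mdifferentiableAt hX (by simp)

/-- Smoothness of order `∞` at a point provides a neighbourhood for each finite order only, hence
the passage to order one. Identities between fields must hold near the point whenever they are
differentiated again. -/
theorem VFSmoothAt.eventually_vfdiffAt {X : Π x : M, TangentSpace I x} {x : M}
    (hX : VFSmoothAt X x) : ∀ᶠ y in 𝓝 x, VFDiffAt X y := by
  have h1 : ContMDiffAt I I.tangent 1 (fun y => (⟨y, X y⟩ : TangentBundle I M)) x :=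
    ContMDiffAt.of_le hX (by simp)
  filter_upwards [(contMDiffAt_iff_contMDiffAt_nhds (by simp)).1 h1] with y hy
  exact hy.mdifferentiableAt (by simp)

theorem eventually_mdifferentiableAt {F : Type*} [NormedAddCommGroup F] [NormedSpace ℝ F]
    {f : M → F} {x : M} (hf : ContMDiffAt I 𝓘(ℝ, F) ∞ f x) :
    ∀ᶠ y in 𝓝 x, MDifferentiableAt I 𝓘(ℝ, F) f y := by
  have h1 : ContMDiffAt I 𝓘(ℝ, F) 1 f x := ContMDiffAt.of_le hf (by simp)
  filter_upwards [(contMDiffAt_iff_contMDiffAt_nhds (by simp)).1 h1] with y hy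
  exact hy.mdifferentiableAt (by simp)

theorem vfsmoothAt_extend {x y : M} (u : TangentSpace I x)
    (hy : y ∈ (trivializationAt E (TangentSpace I : M → Type _) x).baseSet) :
    VFSmoothAt (FiberBundle.extend E u) y := by
  set t := trivializationAt E (TangentSpace I : M → Type _) x with ht
  refine (t.contMDiffAt_section_iff (IB := I) hy).2 ?_
  have : ContMDiffAt I 𝓘(ℝ, E) ∞ (fun _ : M => (t ⟨x, u⟩).2) y := contMDiffAt_const
  refine this.congr_of_eventuallyEq ?_
  filter_upwards [t.open_baseSet.mem_nhds hy] with z hz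
  simp [FiberBundle.extend, ← ht, hz]

theorem vfsmoothAt_extend_self {x : M} (u : TangentSpace I x) :
    VFSmoothAt (FiberBundle.extend E u) x :=
  vfsmoothAt_extend u (FiberBundle.mem_baseSet_trivializationAt' x)

theorem VFSmoothAt.mlieBracket [CompleteSpace E] {X Y : Π x : M, TangentSpace I x} {x : M}
    (hX : VFSmoothAt X x) (hY : VFSmoothAt Y x) : VFSmoothAt (mlieBracket I X Y) x := by
  have : IsManifold I (minSmoothness ℝ 2) M :=
    IsManifold.of_le (n := ∞) (by simpa using two_le_infty)
  have : IsManifold I (((⊤ : ℕ∞) : WithTop ℕ∞) + 1) M :=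
    IsManifold.of_le (n := ∞) (by simp)
  exact ContMDiffAt.mlieBracket_vectorField (I := I) (m := ⊤) (n := ⊤) hX hY (by simp)

theorem jacobi_mlieBracket [CompleteSpace E] {X Y Z : Π x : M, TangentSpace I x} {x : M}
    (hX : VFSmoothAt X x) (hY : VFSmoothAt Y x) (hZ : VFSmoothAt Z x) :
    mlieBracket I X (mlieBracket I Y Z) x =
      mlieBracket I (mlieBracket I X Y) Z x + mlieBracket I Y (mlieBracket I X Z) x := by
  have : IsManifold I (minSmoothness ℝ 3) M :=
    IsManifold.of_le (n := ∞) (by simpa using three_le_infty)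
  exact leibniz_identity_mlieBracket_apply (ContMDiffAt.of_le hX (by simpa using two_le_infty))
    (ContMDiffAt.of_le hY (by simpa using two_le_infty))
    (ContMDiffAt.of_le hZ (by simpa using two_le_infty))

variable {E' : Type*} [NormedAddCommGroup E'] [NormedSpace ℝ E']
  {H' : Type*} [TopologicalSpace H'] {J : ModelWithCorners ℝ E' H'}
  {N : Type*} [TopologicalSpace N] [ChartedSpace H' N] [IsManifold J ∞ N]

theorem contMDiffAt_mfderiv_apply {f : N → M} {x : N} (hf : ContMDiffAt J I ∞ f x)
    {X : Π q : N, TangentSpace J q} (hX : VFSmoothAt X x) :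
    ContMDiffAt J I.tangent ∞ (fun q => (⟨f q, mfderiv J I f q (X q)⟩ : TangentBundle I M)) x := by
  exact ContMDiffAt.clm_apply_of_inCoordinates (hf.mfderiv_const (m := ∞) (by simp)) hX hf

theorem contMDiffAt_mvfderiv_apply {F : Type*} [NormedAddCommGroup F] [NormedSpace ℝ F]
    {f : M → F} {x : M} (hf : ContMDiffAt I 𝓘(ℝ, F) ∞ f x)
    {X : Π q : M, TangentSpace I q} (hX : VFSmoothAt X x) :
    ContMDiffAt I 𝓘(ℝ, F) ∞ (fun q => mvfderiv I f q (X q)) x := by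
  have := (Bundle.contMDiffAt_totalSpace.1 (contMDiffAt_mfderiv_apply hf hX)).2
  simp only [mfld_simps] at this
  exact this

/-- The Lie bracket acts on functions as the commutator of derivations. -/
theorem mvfderiv_mlieBracket [CompleteSpace E] [I.Boundaryless]
    {F : Type*} [NormedAddCommGroup F] [NormedSpace ℝ F]
    {f : M → F} {x : M} (hf : ContMDiffAt I 𝓘(ℝ, F) ∞ f x)
    {X Y : Π q : M, TangentSpace I q} (hX : VFSmoothAt X x) (hY : VFSmoothAt Y x) :
    mvfderiv I f x (mlieBracket I X Y x)
      = mvfderiv I (fun q => mvfderiv I f q (Y q)) x (X x)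
        - mvfderiv I (fun q => mvfderiv I f q (X q)) x (Y x) := by
  have : IsManifold I (minSmoothness ℝ 2) M :=
    IsManifold.of_le (n := ∞) (by simpa using two_le_infty)
  set e : E → M := fun z => (extChartAt I x).symm z with he
  set z₀ : E := extChartAt I x x with hz₀
  have hez : e z₀ = x := extChartAt_to_inv x
  have htgt : ∀ᶠ z in 𝓝 z₀, z ∈ (extChartAt I x).target := extChartAt_target_mem_nhds x
  have hesm : ∀ z ∈ (extChartAt I x).target, ContMDiffAt 𝓘(ℝ, E) I ∞ e z := fun z hz =>
    (contMDiffOn_extChartAt_symm x).contMDiffAt ((isOpen_extChartAt_target x).mem_nhds hz)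
  have hinv : ∀ z ∈ (extChartAt I x).target, (mfderiv 𝓘(ℝ, E) I e z).IsInvertible := fun z hz => by
    have := isInvertible_mfderivWithin_extChartAt_symm (I := I) hz
    rwa [I.range_eq_univ, mfderivWithin_univ] at this
  have hz₀t : z₀ ∈ (extChartAt I x).target := mem_extChartAt_target x
  -- Everything is transported to the model space by the inverse chart, whose derivative is
  -- invertible on the whole target because there is no boundary.
  let P : (Π q : M, TangentSpace I q) → E → E := fun V => mpullback 𝓘(ℝ, E) I e V
  have hP : ∀ V : Π q : M, TangentSpace I q, ∀ z ∈ (extChartAt I x).target,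
      mfderiv 𝓘(ℝ, E) I e z (P V z) = V (e z) := fun V z hz =>
    (hinv z hz).self_apply_inverse _
  have hPd : ∀ V : Π q : M, TangentSpace I q, VFSmoothAt V x → DifferentiableAt ℝ (P V) z₀ := by
    intro V hV
    have h1 : ContMDiffAt 𝓘(ℝ, E) (𝓘(ℝ, E)).tangent 1
        (fun z => (⟨z, P V z⟩ : TangentBundle 𝓘(ℝ, E) E)) z₀ := by
      refine ContMDiffAt.mpullback_vectorField_preimage (n := 2) ?_
        ((hesm z₀ hz₀t).of_le two_le_infty) (hinv z₀ hz₀t) (by norm_num)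
      rw [hez]; exact ContMDiffAt.of_le hV (by simp)
    exact (contMDiffAt_vectorSpace_iff_contDiffAt.1 h1).differentiableAt (by simp)
  have hfe : ContDiffAt ℝ ∞ (f ∘ e) z₀ := by
    rw [← contMDiffAt_iff_contDiffAt]
    exact ContMDiffAt.comp_of_eq hf (hesm z₀ hz₀t) hez
  have hfd : ∀ᶠ z in 𝓝 z₀, MDifferentiableAt I 𝓘(ℝ, F) f (e z) := by
    have hc : Filter.Tendsto e (𝓝 z₀) (𝓝 x) := by
      have := (hesm z₀ hz₀t).continuousAt
      rwa [ContinuousAt, hez] at this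
    exact hc.eventually (eventually_mdifferentiableAt hf)
  have hchain : ∀ (h : M → F) z, z ∈ (extChartAt I x).target →
      MDifferentiableAt I 𝓘(ℝ, F) h (e z) → ∀ V : Π q : M, TangentSpace I q,
      mvfderiv I h (e z) (V (e z)) = fderiv ℝ (h ∘ e) z (P V z) := by
    intro h z hz hh V
    have h1 : mfderiv 𝓘(ℝ, E) 𝓘(ℝ, F) (h ∘ e) z (P V z)
        = mfderiv I 𝓘(ℝ, F) h (e z) (mfderiv 𝓘(ℝ, E) I e z (P V z)) :=
      mfderiv_comp_apply z hh ((hesm z hz).mdifferentiableAt (by simp)) _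
    rw [hP V z hz, mfderiv_eq_fderiv] at h1
    exact h1.symm
  have hder : ∀ V : Π q : M, TangentSpace I q,
      (fun q => mvfderiv I f q (V q)) ∘ e =ᶠ[𝓝 z₀] fun z => fderiv ℝ (f ∘ e) z (P V z) := by
    intro V
    filter_upwards [htgt, hfd] with z hz hz'
    exact hchain f z hz hz' V
  have hsecond : ∀ V W : Π q : M, TangentSpace I q, VFSmoothAt V x → VFSmoothAt W x →
      mvfderiv I (fun q => mvfderiv I f q (V q)) x (W x)
        = fderiv ℝ (fderiv ℝ (f ∘ e)) z₀ (P W z₀) (P V z₀)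
          + fderiv ℝ (f ∘ e) z₀ (fderiv ℝ (P V) z₀ (P W z₀)) := by
    intro V W hV hW
    have h1 := hchain (fun q => mvfderiv I f q (V q)) z₀ hz₀t (by
      rw [hez]
      exact (contMDiffAt_mvfderiv_apply hf hV).mdifferentiableAt (by simp)) W
    rw [hez] at h1
    rw [h1, (hder V).fderiv_eq]
    have h2 : DifferentiableAt ℝ (fderiv ℝ (f ∘ e)) z₀ :=
      (hfe.fderiv_right (m := 1) (by rw [one_add_one_eq_two]; exact two_le_infty)).differentiableAt (by simp)
    rw [fderiv_clm_apply h2 (hPd V hV)]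
    simp [add_comm]
  have hbr : mvfderiv I f x (mlieBracket I X Y x)
      = fderiv ℝ (f ∘ e) z₀ (lieBracket ℝ (P X) (P Y) z₀) := by
    have h1 := hchain f z₀ hz₀t (by rw [hez]; exact hf.mdifferentiableAt (by simp))
      (mlieBracket I X Y)
    rw [hez] at h1
    rw [h1]
    congr 1
    have h2 := mpullback_mlieBracket (I := 𝓘(ℝ, E)) (I' := I) (f := e) (V := X) (W := Y)
      (x₀ := z₀) (n := 2) (by rw [hez]; exact hX.vfdiffAt) (by rw [hez]; exact hY.vfdiffAt)
      ((hesm z₀ hz₀t).of_le two_le_infty) (by simp)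
    rw [← mlieBracketWithin_univ (I := 𝓘(ℝ, E)), mlieBracketWithin_eq_lieBracketWithin] at h2
    have h3 : lieBracketWithin ℝ (P X) (P Y) Set.univ z₀ = lieBracket ℝ (P X) (P Y) z₀ := by
      rw [lieBracketWithin_univ]
    exact h2.trans h3
  -- In coordinates the two iterated derivatives differ by first-order terms, which form the
  -- bracket, and by second derivatives, which cancel by symmetry.
  have hsymm := (hfe.isSymmSndFDerivAt (by simpa using two_le_infty)).eq (P X z₀) (P Y z₀)
  rw [hbr, hsecond Y X hY hX, hsecond X Y hX hY, hsymm, lieBracket_eq]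
  simp

/-- Lie brackets of `φ`-related vector fields are `φ`-related. -/
theorem mlieBracket_of_related [CompleteSpace E] [I.Boundaryless] [CompleteSpace E']
    [J.Boundaryless] {φ : N → M} {q : N} (hφ : ContMDiffAt J I ∞ φ q)
    {X Z : Π y : M, TangentSpace I y} (hX : VFSmoothAt X (φ q)) (hZ : VFSmoothAt Z (φ q))
    {x z : Π p : N, TangentSpace J p} (hx : VFSmoothAt x q) (hz : VFSmoothAt z q)
    (hXx : ∀ᶠ p in 𝓝 q, X (φ p) = mfderiv J I φ p (x p))
    (hZz : ∀ᶠ p in 𝓝 q, Z (φ p) = mfderiv J I φ p (z p)) :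
    mlieBracket I X Z (φ q) = mfderiv J I φ q (mlieBracket J x z q) := by
  -- The map `φ` is not a local diffeomorphism, so brackets cannot simply be pulled back. Instead
  -- both sides act as derivations on the vector-valued chart at `φ q`, whose derivative is
  -- injective.
  have hf : ContMDiffAt I 𝓘(ℝ, E) ∞ (extChartAt I (φ q)) (φ q) := contMDiffAt_extChartAt
  have hφd := hφ.mdifferentiableAt (by simp)
  have hrel : ∀ {V : Π y : M, TangentSpace I y} {v : Π p : N, TangentSpace J p},
      (∀ᶠ p in 𝓝 q, V (φ p) = mfderiv J I φ p (v p)) →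
      (fun y => mvfderiv I (extChartAt I (φ q)) y (V y)) ∘ φ =ᶠ[𝓝 q]
        fun p => mvfderiv J (extChartAt I (φ q) ∘ φ) p (v p) := by
    intro V v hV
    filter_upwards [hV, hφ.continuousAt.eventually (eventually_mdifferentiableAt hf),
      (contMDiffAt_iff_contMDiffAt_nhds (n := 1) (by simp)).1 (hφ.of_le (by simp))]
      with p hp hp2 hp3
    simp only [Function.comp_apply]
    rw [hp]
    exact (mfderiv_comp_apply p hp2 (hp3.mdifferentiableAt (by simp)) _).symm
  have hch : ∀ {V : Π y : M, TangentSpace I y} {v : Π p : N, TangentSpace J p}, VFSmoothAt V (φ q) →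
      (∀ᶠ p in 𝓝 q, V (φ p) = mfderiv J I φ p (v p)) → ∀ u : TangentSpace J q,
      mvfderiv I (fun y => mvfderiv I (extChartAt I (φ q)) y (V y)) (φ q) (mfderiv J I φ q u)
        = mvfderiv J (fun p => mvfderiv J (extChartAt I (φ q) ∘ φ) p (v p)) q u := by
    intro V v hVs hV u
    have h1 := mfderiv_comp_apply q ((contMDiffAt_mvfderiv_apply hf hVs).mdifferentiableAt
      (by simp)) hφd u
    have h2 := congrArg (fun A => A u) ((hrel hV).mfderiv_eq (I := J) (I' := 𝓘(ℝ, E)))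
    exact h1.symm.trans h2
  have e1 := mvfderiv_mlieBracket hf hX hZ
  have e2 := mvfderiv_mlieBracket (hf.comp q hφ) hx hz
  rw [hXx.self_of_nhds, hZz.self_of_nhds, hch hZ hZz, hch hX hXx, ← e2] at e1
  have e3 : mvfderiv J (extChartAt I (φ q) ∘ φ) q (mlieBracket J x z q)
      = mvfderiv I (extChartAt I (φ q)) (φ q) (mfderiv J I φ q (mlieBracket J x z q)) :=
    mfderiv_comp_apply q (hf.mdifferentiableAt (by simp)) hφd _
  rw [e3] at e1
  exact (isInvertible_mfderiv_extChartAt (I := I) (mem_extChartAt_source (φ q))).injective e1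

end
end SmoothCalculus

/-! ### Smoothness of tensor fields and tensoriality of their Lie and covariant derivatives. -/

section TensorFields

variable {E : Type*} [NormedAddCommGroup E] [NormedSpace ℝ E]
  {H : Type*} [TopologicalSpace H] {I : ModelWithCorners ℝ E H}
  {M : Type*} [TopologicalSpace M] [ChartedSpace H M]
  [FiniteDimensional ℝ E] [CompleteSpace E] [IsManifold I ∞ M]

/-- In finite dimension a linear map is a tuple of its values on a basis, so smoothness can be
tested on each vector separately. -/
theorem contMDiffAt_clm_of_apply {F : Type*} [NormedAddCommGroup F] [NormedSpace ℝ F]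
    {f : M → E →L[ℝ] F} {x : M} (h : ∀ u, ContMDiffAt I 𝓘(ℝ, F) ∞ (fun y => f y u) x) :
    ContMDiffAt I 𝓘(ℝ, E →L[ℝ] F) ∞ f x := by
  let d := Module.finrank ℝ E
  have hd : d = Module.finrank ℝ (Fin d → ℝ) := (Module.finrank_fin_fun ℝ).symm
  let e₁ := ContinuousLinearEquiv.ofFinrankEq hd
  let e₂ := (e₁.arrowCongr (1 : F ≃L[ℝ] F)).trans (ContinuousLinearEquiv.piRing (Fin d))
  have h1 : ContMDiffAt I 𝓘(ℝ, Fin d → F) ∞ (fun y => e₂ (f y)) x :=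
    contMDiffAt_pi_space.2 fun i => h _
  have h2 : ContMDiffAt I 𝓘(ℝ, E →L[ℝ] F) ∞ (fun y => e₂.symm (e₂ (f y))) x :=
    e₂.symm.contDiff.contMDiff.contMDiffAt.comp x h1
  simpa using h2

/-- The `(0,2)`-tensor field `T` is smooth at `x`. -/
def SmoothTensor₂At (T : Π x : M, TangentSpace I x →L[ℝ] TangentSpace I x →L[ℝ] ℝ) (x : M) :
    Prop :=
  ContMDiffAt I (I.prod 𝓘(ℝ, E →L[ℝ] E →L[ℝ] ℝ)) ∞
    (fun x => Bundle.TotalSpace.mk' (E →L[ℝ] E →L[ℝ] ℝ)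
      (E := fun x : M => TangentSpace I x →L[ℝ] TangentSpace I x →L[ℝ] ℝ) x (T x)) x

variable {T : Π x : M, TangentSpace I x →L[ℝ] TangentSpace I x →L[ℝ] ℝ}
  {a : Π x : M, TangentSpace I x →L[ℝ] ℝ} {x : M}

theorem SmoothTensor₂At.mdiffAt (hT : SmoothTensor₂At T x) {X Y : Π x : M, TangentSpace I x}
    (hX : VFDiffAt X x) (hY : VFDiffAt Y x) :
    MDifferentiableAt I 𝓘(ℝ) (fun y => T y (X y) (Y y)) x := by
  have h1 : MDifferentiableAt I (I.prod 𝓘(ℝ, E →L[ℝ] E →L[ℝ] ℝ))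
      (fun x => Bundle.TotalSpace.mk' (E →L[ℝ] E →L[ℝ] ℝ)
      (E := fun x : M => TangentSpace I x →L[ℝ] TangentSpace I x →L[ℝ] ℝ) x (T x)) x :=
    ContMDiffAt.mdifferentiableAt hT (by simp)
  have : MDifferentiableAt I (I.prod 𝓘(ℝ))
      (fun m ↦ Bundle.TotalSpace.mk' ℝ (E := Bundle.Trivial M ℝ) m (T m (X m) (Y m))) x := by
    apply MDifferentiableAt.clm_bundle_apply₂ (F₁ := E) (F₂ := E)
    · exact h1
    · exact hX
    · exact hY
  rw [mdifferentiableAt_totalSpace] at this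
  exact this.2

theorem SmoothTensor₂At.contMDiffAt (hT : SmoothTensor₂At T x)
    {X Y : Π x : M, TangentSpace I x} (hX : VFSmoothAt X x) (hY : VFSmoothAt Y x) :
    ContMDiffAt I 𝓘(ℝ) ∞ (fun y => T y (X y) (Y y)) x := by
  have : ContMDiffAt I (I.prod 𝓘(ℝ)) ∞
      (fun m ↦ Bundle.TotalSpace.mk' ℝ (E := Bundle.Trivial M ℝ) m (T m (X m) (Y m))) x := by
    apply ContMDiffAt.clm_bundle_apply₂ (F₁ := E) (F₂ := E)
    · exact hT
    · exact hX
    · exact hY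
  exact (Bundle.contMDiffAt_totalSpace.1 this).2

theorem inCoordinates_tensor₁_apply (a : Π x : M, TangentSpace I x →L[ℝ] ℝ) (x : M) {y : M}
    (hy : y ∈ (trivializationAt E (fun y : M => TangentSpace I y) x).baseSet) (u : E) :
    ContinuousLinearMap.inCoordinates E (fun y : M => TangentSpace I y) ℝ
      (fun _ : M => ℝ) x y x y (a y) u
      = a y ((trivializationAt E (fun y : M => TangentSpace I y) x).symm y u) := by
  simp only [ContinuousLinearMap.inCoordinates]
  rw [← Bundle.Trivialization.symmL_apply (R := ℝ) _ hy]
  simp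

theorem inCoordinates_tensor₂_apply
    (T : Π x : M, TangentSpace I x →L[ℝ] TangentSpace I x →L[ℝ] ℝ) (x : M) {y : M}
    (hy : y ∈ (trivializationAt E (fun y : M => TangentSpace I y) x).baseSet) (u v : E) :
    ContinuousLinearMap.inCoordinates E (fun y : M => TangentSpace I y) (E →L[ℝ] ℝ)
      (fun y : M => TangentSpace I y →L[ℝ] ℝ) x y x y (T y) u v
      = T y ((trivializationAt E (fun y : M => TangentSpace I y) x).symm y u)
          ((trivializationAt E (fun y : M => TangentSpace I y) x).symm y v) := by
  erw [inCoordinates_apply_eq₂ hy hy (by simp)]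
  simp

/-- Identifies the frame fields of the trivialization with canonical extensions of vectors, so that
coordinate components of a tensor become its values on vector fields. -/
theorem extend_symm_apply (x y : M) (u : E) :
    FiberBundle.extend E
      ((trivializationAt E (fun y : M => TangentSpace I y) x).symm x u : TangentSpace I x) y
      = (trivializationAt E (fun y : M => TangentSpace I y) x).symm y u := by
  simp only [FiberBundle.extend]
  rw [(trivializationAt E (fun y : M => TangentSpace I y) x).apply_mk_symm
    (FiberBundle.mem_baseSet_trivializationAt' x)]

/-- A covector field is smooth if its components in a frame are. -/
theorem smoothTensor₁At_of_extend
    (h : ∀ u : TangentSpace I x, ContMDiffAt I 𝓘(ℝ) ∞ (fun y => a y (FiberBundle.extend E u y)) x) :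
    ContMDiffAt I (I.prod 𝓘(ℝ, E →L[ℝ] ℝ)) ∞
    (fun x => Bundle.TotalSpace.mk' (E →L[ℝ] ℝ)
      (E := fun x : M => TangentSpace I x →L[ℝ] ℝ) x (a x)) x := by
  refine (contMDiffAt_hom_bundle _).2 ⟨contMDiffAt_id, contMDiffAt_clm_of_apply fun u => ?_⟩
  refine (h ((trivializationAt E (fun y : M => TangentSpace I y) x).symm x
    u)).congr_of_eventuallyEq ?_
  filter_upwards [(trivializationAt E (fun y : M => TangentSpace I y) x).open_baseSet.mem_nhds
    (FiberBundle.mem_baseSet_trivializationAt' x)] with y hy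
  rw [extend_symm_apply]
  exact inCoordinates_tensor₁_apply a x hy u

/-- A `(0,2)`-tensor field is smooth if its components in a frame are. -/
theorem smoothTensor₂At_of_extend
    (h : ∀ u v : TangentSpace I x, ContMDiffAt I 𝓘(ℝ) ∞
      (fun y => T y (FiberBundle.extend E u y) (FiberBundle.extend E v y)) x) :
    SmoothTensor₂At T x := by
  refine (contMDiffAt_hom_bundle _).2 ⟨contMDiffAt_id, contMDiffAt_clm_of_apply fun u =>
    contMDiffAt_clm_of_apply fun v => ?_⟩
  refine (h ((trivializationAt E (fun y : M => TangentSpace I y) x).symm x u)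
    ((trivializationAt E (fun y : M => TangentSpace I y) x).symm x
    v)).congr_of_eventuallyEq ?_
  filter_upwards [(trivializationAt E (fun y : M => TangentSpace I y) x).open_baseSet.mem_nhds
    (FiberBundle.mem_baseSet_trivializationAt' x)] with y hy
  rw [extend_symm_apply, extend_symm_apply]
  exact inCoordinates_tensor₂_apply T x hy u v

section Lie

variable (T) in
/-- The Lie derivative of a `(0,2)`-tensor field, evaluated on vector fields. -/
def lieExpr (X Y Z : Π x : M, TangentSpace I x) (x : M) : ℝ :=
  mvfderiv I (fun y => T y (Y y) (Z y)) x (X x)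
    - T x (mlieBracket I X Y x) (Z x) - T x (Y x) (mlieBracket I X Z x)

/-- The term `X(f) T(Y,Z)` from the product rule cancels the one from `[X, fY]`. No regularity of
`X` enters, so the Lie derivative is a bilinear form at every point, even away from the region where
`η` is smooth. -/
theorem lieExpr_tensorial_left (hT : SmoothTensor₂At T x) (X : Π x : M, TangentSpace I x)
    {Z : Π x : M, TangentSpace I x} (hZ : VFDiffAt Z x) :
    TensorialAt I E (fun Y => lieExpr T X Y Z x) x where
  smul {f Y} hf hY := by
    simp [lieExpr, mlieBracket_smul_right hf hY, mvfderiv_fun_mul hf (hT.mdiffAt hY hZ)]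
    ring
  add {Y Y'} hY hY' := by
    simp [lieExpr, mlieBracket_add_right hY hY',
      mvfderiv_fun_add (hT.mdiffAt hY hZ) (hT.mdiffAt hY' hZ)]
    ring

theorem lieExpr_tensorial_right (hT : SmoothTensor₂At T x) (X : Π x : M, TangentSpace I x)
    {Y : Π x : M, TangentSpace I x} (hY : VFDiffAt Y x) :
    TensorialAt I E (fun Z => lieExpr T X Y Z x) x where
  smul {f Z} hf hZ := by
    simp [lieExpr, mlieBracket_smul_right hf hZ, mvfderiv_fun_mul hf (hT.mdiffAt hY hZ)]
    ring
  add {Z Z'} hZ hZ' := by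
    simp [lieExpr, mlieBracket_add_right hZ hZ',
      mvfderiv_fun_add (hT.mdiffAt hY hZ) (hT.mdiffAt hY hZ')]
    ring

/-- By tensoriality the canonical extensions may be replaced by arbitrary differentiable fields with
the same values, in particular by fields adapted to the hypersurface. -/
theorem lieDeriv₂_eq_lieExpr (hT : SmoothTensor₂At T x) (X : Π x : M, TangentSpace I x)
    {Y Z : Π x : M, TangentSpace I x} (hY : VFDiffAt Y x) (hZ : VFDiffAt Z x) :
    lieDeriv₂ X (fun x u v => T x u v) x (Y x) (Z x) = lieExpr T X Y Z x := by
  have := TensorialAt.pointwise₂ (Φ := fun Y Z => lieExpr T X Y Z x)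
    (fun Z hZ => lieExpr_tensorial_left hT X hZ) (fun Y hY => lieExpr_tensorial_right hT X hY)
    (vfdiffAt_extend (Y x)) hY (vfdiffAt_extend (Z x)) hZ (by simp) (by simp)
  rw [← this]
  simp [lieExpr, lieDeriv₂]

/-- The Lie derivative of a smooth `(0,2)`-tensor field, as a field of continuous bilinear forms. -/
def lieTensor (hT : SmoothTensor₂ T) (X : Π x : M, TangentSpace I x) (x : M) :
    TangentSpace I x →L[ℝ] TangentSpace I x →L[ℝ] ℝ :=
  TensorialAt.mkHom₂ (I := I) (F := E) (F' := E) (fun Y Z => lieExpr T X Y Z x) x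
    (fun _ hZ => lieExpr_tensorial_left (hT x) X hZ)
    (fun _ hY => lieExpr_tensorial_right (hT x) X hY)

theorem lieTensor_apply (hT : SmoothTensor₂ T) (X : Π x : M, TangentSpace I x)
    {Y Z : Π x : M, TangentSpace I x} (hY : VFDiffAt Y x) (hZ : VFDiffAt Z x) :
    lieTensor hT X x (Y x) (Z x) = lieExpr T X Y Z x :=
  TensorialAt.mkHom₂_apply _ _ hY hZ

theorem lieDeriv₂_eq_lieTensor (hT : SmoothTensor₂ T) (X : Π x : M, TangentSpace I x)
    (u v : TangentSpace I x) :
    lieDeriv₂ X (fun x u v => T x u v) x u v = lieTensor hT X x u v := by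
  have h1 := lieDeriv₂_eq_lieExpr (hT x) X (vfdiffAt_extend u) (vfdiffAt_extend v)
  have h2 := lieTensor_apply hT X (vfdiffAt_extend u) (vfdiffAt_extend v)
  rw [FiberBundle.extend_apply_self, FiberBundle.extend_apply_self] at h1 h2
  rw [h1, h2]

theorem lieExpr_symm (hs : ∀ x u v, T x u v = T x v u) (X Y Z : Π x : M, TangentSpace I x) :
    lieExpr T X Y Z x = lieExpr T X Z Y x := by
  have h : (fun y => T y (Y y) (Z y)) = fun y => T y (Z y) (Y y) := by
    funext y; exact hs _ _ _
  rw [lieExpr, lieExpr, h, hs x (mlieBracket I X Y x), hs x (Y x)]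
  ring

theorem lieTensor_symm (hT : SmoothTensor₂ T) (hs : ∀ x u v, T x u v = T x v u)
    (X : Π x : M, TangentSpace I x) (u v : TangentSpace I x) :
    lieTensor hT X x u v = lieTensor hT X x v u :=
  lieExpr_symm hs X _ _

/-- Smoothness is stated at a point because the field `η` is controlled only near the hypersurface.
-/
theorem smoothTensor₂At_lieTensor (hT : SmoothTensor₂ T) {X : Π x : M, TangentSpace I x}
    (hX : VFSmoothAt X x) : SmoothTensor₂At (lieTensor hT X) x := by
  refine smoothTensor₂At_of_extend fun u v => ?_
  have hu := vfsmoothAt_extend_self u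
  have hv := vfsmoothAt_extend_self v
  have h : ContMDiffAt I 𝓘(ℝ) ∞
      (fun y => lieExpr T X (FiberBundle.extend E u) (FiberBundle.extend E v) y) x :=
    ((contMDiffAt_mvfderiv_apply (SmoothTensor₂At.contMDiffAt (hT x) hu hv) hX).sub
      (SmoothTensor₂At.contMDiffAt (hT x) (hX.mlieBracket hu) hv)).sub
      (SmoothTensor₂At.contMDiffAt (hT x) hu (hX.mlieBracket hv))
  refine h.congr_of_eventuallyEq ?_
  filter_upwards [hu.eventually_vfdiffAt, hv.eventually_vfdiffAt] with y hy hy'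
  exact lieTensor_apply hT X hy hy'

end Lie

section Covariant

variable (nab : CovariantDerivative I E (TangentSpace I : M → Type _))

variable (T) in
/-- The covariant derivative of a `(0,2)`-tensor field, evaluated on vector fields. -/
def covExpr (u : TangentSpace I x) (Y Z : Π x : M, TangentSpace I x) : ℝ :=
  mvfderiv I (fun y => T y (Y y) (Z y)) x u
    - T x (nab Y x u) (Z x) - T x (Y x) (nab Z x u)

theorem covExpr_tensorial_left (hT : SmoothTensor₂At T x) (u : TangentSpace I x)
    {Z : Π x : M, TangentSpace I x} (hZ : VFDiffAt Z x) :
    TensorialAt I E (fun Y => covExpr T nab u Y Z) x where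
  smul {f Y} hf hY := by
    simp [covExpr, (nab.isCovariantDerivativeOn (s := Set.univ)).leibniz hY hf, mvfderiv_fun_mul hf (hT.mdiffAt hY hZ)]
    ring
  add {Y Y'} hY hY' := by
    simp [covExpr, (nab.isCovariantDerivativeOn (s := Set.univ)).add hY hY',
      mvfderiv_fun_add (hT.mdiffAt hY hZ) (hT.mdiffAt hY' hZ)]
    ring

theorem covExpr_tensorial_right (hT : SmoothTensor₂At T x) (u : TangentSpace I x)
    {Y : Π x : M, TangentSpace I x} (hY : VFDiffAt Y x) :
    TensorialAt I E (fun Z => covExpr T nab u Y Z) x where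
  smul {f Z} hf hZ := by
    simp [covExpr, (nab.isCovariantDerivativeOn (s := Set.univ)).leibniz hZ hf, mvfderiv_fun_mul hf (hT.mdiffAt hY hZ)]
    ring
  add {Z Z'} hZ hZ' := by
    simp [covExpr, (nab.isCovariantDerivativeOn (s := Set.univ)).add hZ hZ',
      mvfderiv_fun_add (hT.mdiffAt hY hZ) (hT.mdiffAt hY hZ')]
    ring

theorem covDeriv₂_eq_covExpr (hT : SmoothTensor₂At T x) (u : TangentSpace I x)
    {Y Z : Π x : M, TangentSpace I x} (hY : VFDiffAt Y x) (hZ : VFDiffAt Z x) :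
    covDeriv₂ nab (fun x u v => T x u v) x u (Y x) (Z x) = covExpr T nab u Y Z := by
  have := TensorialAt.pointwise₂ (Φ := fun Y Z => covExpr T nab u Y Z)
    (fun Z hZ => covExpr_tensorial_left nab hT u hZ)
    (fun Y hY => covExpr_tensorial_right nab hT u hY)
    (vfdiffAt_extend (Y x)) hY (vfdiffAt_extend (Z x)) hZ (by simp) (by simp)
  rw [← this]
  simp [covExpr, covDeriv₂]

end Covariant

end TensorFields

/-! ### The Levi-Civita connection and its Lie derivative. -/

section LeviCivita

variable {E : Type*} [NormedAddCommGroup E] [NormedSpace ℝ E]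
  {H : Type*} [TopologicalSpace H] {I : ModelWithCorners ℝ E H}
  {M : Type*} [TopologicalSpace M] [ChartedSpace H M]
  [FiniteDimensional ℝ E] [CompleteSpace E] [IsManifold I ∞ M]
  {x : M}

/-- A vector field whose contractions with a nondegenerate smooth form are smooth is smooth. -/
theorem vfsmoothAt_of_dual {h : Π x : M, TangentSpace I x →L[ℝ] TangentSpace I x →L[ℝ] ℝ}
    (hh : SmoothTensor₂At h x) (hinj : ∀ u, (∀ v, h x u v = 0) → u = 0)
    {V : Π x : M, TangentSpace I x}
    (hV : ∀ u : TangentSpace I x,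
      ContMDiffAt I 𝓘(ℝ) ∞ (fun y => h y (V y) (FiberBundle.extend E u y)) x) :
    VFSmoothAt V x := by
  have ha := smoothTensor₁At_of_extend (a := fun y => h y (V y)) hV
  have h1 := ((contMDiffAt_hom_bundle _).1 hh).2
  have h2 := ((contMDiffAt_hom_bundle _).1 ha).2
  simp only at h1 h2
  set hc : M → (E →L[ℝ] E →L[ℝ] ℝ) := fun y =>
    ContinuousLinearMap.inCoordinates E (fun y : M => TangentSpace I y) (E →L[ℝ] ℝ)
      (fun y : M => TangentSpace I y →L[ℝ] ℝ) x y x y (h y) with hhc0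
  set ac : M → (E →L[ℝ] ℝ) := fun y =>
    ContinuousLinearMap.inCoordinates E (fun y : M => TangentSpace I y) ℝ
      (fun _ : M => ℝ) x y x y (h y (V y)) with hac0
  set t := trivializationAt E (fun y : M => TangentSpace I y) x with ht
  have hxb : x ∈ t.baseSet := FiberBundle.mem_baseSet_trivializationAt' x
  have happ : ∀ y ∈ t.baseSet, ∀ u v, hc y u v = h y (t.symm y u) (t.symm y v) :=
    fun y hy u v => inCoordinates_tensor₂_apply h x hy u v
  have haapp : ∀ y ∈ t.baseSet, ∀ v, ac y v = h y (V y) (t.symm y v) :=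
    fun y hy v => inCoordinates_tensor₁_apply (fun y => h y (V y)) x hy v
  have hinv : (hc x).IsInvertible := by
    have hi : Function.Injective (hc x).toLinearMap := by
      rw [← LinearMap.ker_eq_bot, LinearMap.ker_eq_bot']
      intro u hu
      have h0 : t.symm x u = 0 := by
        apply hinj
        intro v
        have := happ x hxb u (t ⟨x, v⟩).2
        have hz : hc x u (t ⟨x, v⟩).2 = 0 := by
          have : hc x u = 0 := hu
          rw [this]; rfl
        rw [hz] at this
        simpa [hxb] using this.symm
      have h3 := (t.continuousLinearEquivAt ℝ x hxb).symm.injective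
        (a₁ := u) (a₂ := 0)
      apply h3
      rw [map_zero, ← h0]
      rfl
    have hd : Module.finrank ℝ E = Module.finrank ℝ (E →L[ℝ] ℝ) := by
      rw [← LinearMap.toContinuousLinearMap.finrank_eq (R := ℝ) (M := E →ₗ[ℝ] ℝ)]
      exact (Subspace.dual_finrank_eq (K := ℝ) (V := E)).symm
    refine ⟨(LinearEquiv.ofInjectiveOfFinrankEq (hc x).toLinearMap hi hd).toContinuousLinearEquiv, ?_⟩
    ext u v
    rfl
  -- Nondegeneracy at the one point `x` suffices: invertible operators form an open set on which
  -- inversion is smooth.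
  have hnear : ∀ᶠ y in 𝓝 x, (hc y).IsInvertible := by
    obtain ⟨e, he⟩ := hinv
    have : {f : E →L[ℝ] E →L[ℝ] ℝ | f.IsInvertible} ∈ 𝓝 (hc x) := by
      rw [← he]; exact ContinuousLinearEquiv.nhds e
    exact h1.continuousAt this
  refine (Bundle.contMDiffAt_section (F := E) (E := fun y : M => TangentSpace I y) x).2 ?_
  have hsol : ContMDiffAt I 𝓘(ℝ, E) ∞ (fun y => (hc y).inverse (ac y)) x := by
    have hi : ContMDiffAt I 𝓘(ℝ, (E →L[ℝ] ℝ) →L[ℝ] E) ∞ (fun y => (hc y).inverse) x :=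
      (hinv.contDiffAt_map_inverse (n := ∞)).contMDiffAt.comp x h1
    exact hi.clm_apply h2
  refine hsol.congr_of_eventuallyEq ?_
  filter_upwards [hnear, t.open_baseSet.mem_nhds hxb] with y hy hyb
  have : hc y (t ⟨y, V y⟩).2 = ac y := by
    ext v
    rw [happ y hyb, haapp y hyb]
    congr 2
    simp [hyb]
  rw [← this]
  exact (ContinuousLinearMap.IsInvertible.inverse_apply_self hy _).symm

theorem isLeviCivita_leviCivita (g : LorentzianMetric I M) : IsLeviCivita g (leviCivita g) :=
  Classical.choose_spec (exists_isLeviCivita g)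

namespace IsLeviCivita

variable {g : LorentzianMetric I M} {nab : CovariantDerivative I E (TangentSpace I : M → Type _)}
  {X Z W η : Π x : M, TangentSpace I x}

theorem koszul_formula (h : IsLeviCivita g nab) (hX : VFDiffAt X x) (hZ : VFDiffAt Z x)
    (hW : VFDiffAt W x) : g.val x (nab Z x (X x)) (W x) = koszul g.val X Z W x := by
  have m1 := h.metric x (X x) Z W hZ hW
  have m2 := h.metric x (Z x) X W hX hW
  have m3 := h.metric x (W x) X Z hX hZ
  have t1 := h.torsion_free x X Z hX hZ
  have t2 := h.torsion_free x X W hX hW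
  have t3 := h.torsion_free x Z W hZ hW
  rw [koszul, m1, m2, m3, ← t1, ← t2, ← t3]
  simp only [map_sub, sub_apply]
  rw [g.symm x (Z x), g.symm x (X x) (nab W x (Z x)), g.symm x (X x) (nab Z x (W x))]
  ring

/-- The connection comes without a smoothness axiom; smoothness is recovered from the Koszul
formula, whose right side is smooth against every frame field. -/
theorem vfsmoothAt_nab (h : IsLeviCivita g nab) (hX : VFSmoothAt X x) (hZ : VFSmoothAt Z x) :
    VFSmoothAt (fun y => nab Z y (X y)) x := by
  refine vfsmoothAt_of_dual (g.smooth x) (g.eq_zero x) fun u => ?_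
  set U : Π x : M, TangentSpace I x := FiberBundle.extend E u
  have hU : VFSmoothAt U x := vfsmoothAt_extend_self u
  have hG : ∀ {A B : Π x : M, TangentSpace I x}, VFSmoothAt A x → VFSmoothAt B x →
      ContMDiffAt I 𝓘(ℝ) ∞ (fun y => g.val y (A y) (B y)) x := fun hA hB =>
    SmoothTensor₂At.contMDiffAt (g.smooth x) hA hB
  have hk : ContMDiffAt I 𝓘(ℝ) ∞ (fun y => koszul g.val X Z U y) x :=
    contMDiffAt_const.mul
      ((((((contMDiffAt_mvfderiv_apply (hG hZ hU) hX).add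
        (contMDiffAt_mvfderiv_apply (hG hX hU) hZ)).sub
        (contMDiffAt_mvfderiv_apply (hG hX hZ) hU)).add
        (hG (hX.mlieBracket hZ) hU)).sub (hG (hX.mlieBracket hU) hZ)).sub
        (hG (hZ.mlieBracket hU) hX))
  refine hk.congr_of_eventuallyEq ?_
  filter_upwards [hX.eventually_vfdiffAt, hZ.eventually_vfdiffAt, hU.eventually_vfdiffAt]
    with y h1 h2 h3
  exact h.koszul_formula h1 h2 h3

/-- Rewriting each antisymmetrized covariant derivative as a bracket turns the difference of the two
sides into the Jacobi identity for `η`, `X`, `Z`. -/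
theorem lieDerivConnection_symm (h : IsLeviCivita g nab) (hη : VFSmoothAt η x)
    (hX : VFSmoothAt X x) (hZ : VFSmoothAt Z x) :
    lieDerivConnection η nab X Z x = lieDerivConnection η nab Z X x := by
  have hXZ := h.vfsmoothAt_nab hX hZ
  have hZX := h.vfsmoothAt_nab hZ hX
  have e1 : (fun y => nab Z y (X y)) =ᶠ[𝓝 x] (fun y => nab X y (Z y)) + mlieBracket I X Z := by
    filter_upwards [hX.eventually_vfdiffAt, hZ.eventually_vfdiffAt] with y h1 h2
    rw [Pi.add_apply, ← h.torsion_free y X Z h1 h2]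
    abel
  have e2 : mlieBracket I η (fun y => nab Z y (X y)) x
      = mlieBracket I η (fun y => nab X y (Z y)) x + mlieBracket I η (mlieBracket I X Z) x := by
    rw [Filter.EventuallyEq.mlieBracket_vectorField_eq (Filter.EventuallyEq.refl _ η) e1]
    exact mlieBracket_add_right hZX.vfdiffAt (hX.mlieBracket hZ).vfdiffAt
  have t1 := h.torsion_free x X (mlieBracket I η Z) hX.vfdiffAt (hη.mlieBracket hZ).vfdiffAt
  have t2 := h.torsion_free x (mlieBracket I η X) Z (hη.mlieBracket hX).vfdiffAt hZ.vfdiffAt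
  have hj := jacobi_mlieBracket hη hX hZ
  rw [← t1, ← t2] at hj
  simp only [lieDerivConnection]
  rw [e2, hj]
  abel

/-- `∇ K` for `K = £_η g` in terms of `£_η ∇`. -/
theorem covExpr_lieTensor [I.Boundaryless] (h : IsLeviCivita g nab) (hη : VFSmoothAt η x)
    (hX : VFSmoothAt X x) (hZ : VFSmoothAt Z x) (hW : VFSmoothAt W x) :
    covExpr (lieTensor g.smooth η) nab (X x) Z W
      = g.val x (lieDerivConnection η nab X Z x) (W x)
        + g.val x (Z x) (lieDerivConnection η nab X W x) := by
  have hG : ∀ {A B : Π x : M, TangentSpace I x}, VFSmoothAt A x → VFSmoothAt B x →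
      ContMDiffAt I 𝓘(ℝ) ∞ (fun y => g.val y (A y) (B y)) x := fun hA hB =>
    SmoothTensor₂At.contMDiffAt (g.smooth x) hA hB
  have hd : ∀ {f : M → ℝ}, ContMDiffAt I 𝓘(ℝ) ∞ f x → MDifferentiableAt I 𝓘(ℝ) f x :=
    fun hf => hf.mdifferentiableAt (by simp)
  have hηZ := hη.mlieBracket hZ
  have hηW := hη.mlieBracket hW
  have hXZ := h.vfsmoothAt_nab hX hZ
  have hXW := h.vfsmoothAt_nab hX hW
  have e1 : mvfderiv I (fun y => lieTensor g.smooth η y (Z y) (W y)) x (X x)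
      = mvfderiv I (fun q => mvfderiv I (fun y => g.val y (Z y) (W y)) q (η q)) x (X x)
        - mvfderiv I (fun y => g.val y (mlieBracket I η Z y) (W y)) x (X x)
        - mvfderiv I (fun y => g.val y (Z y) (mlieBracket I η W y)) x (X x) := by
    have : (fun y => lieTensor g.smooth η y (Z y) (W y)) =ᶠ[𝓝 x] fun y => lieExpr g.val η Z W y := by
      filter_upwards [hZ.eventually_vfdiffAt, hW.eventually_vfdiffAt] with y h1 h2
      exact lieTensor_apply g.smooth η h1 h2
    have h1 : mvfderiv I (fun y => lieTensor g.smooth η y (Z y) (W y)) x (X x)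
        = mvfderiv I (fun y => lieExpr g.val η Z W y) x (X x) :=
      congrArg (fun A => A (X x)) (this.mfderiv_eq (I := I) (I' := 𝓘(ℝ)))
    rw [h1]
    simp only [lieExpr]
    have d1 := hd (contMDiffAt_mvfderiv_apply (hG hZ hW) hη)
    have d2 := hd (hG hηZ hW)
    have d12 : MDifferentiableAt I 𝓘(ℝ) (fun q => mvfderiv I (fun y => g.val y (Z y) (W y)) q (η q)
        - g.val q (mlieBracket I η Z q) (W q)) x := d1.sub d2
    rw [mvfderiv_fun_sub d12 (hd (hG hZ hηW)), mvfderiv_fun_sub d1 d2]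
    rfl
  -- Exchanges the order of `η` and `X` on `g(Z,W)`, so that metricity can be applied to the inner
  -- `X`-derivative before differentiating along `η`.
  have e2 := mvfderiv_mlieBracket (hG hZ hW) hη hX
  have e3 : mvfderiv I (fun q => mvfderiv I (fun y => g.val y (Z y) (W y)) q (X q)) x (η x)
      = mvfderiv I (fun y => g.val y (nab Z y (X y)) (W y)) x (η x)
        + mvfderiv I (fun y => g.val y (Z y) (nab W y (X y))) x (η x) := by
    have : (fun q => mvfderiv I (fun y => g.val y (Z y) (W y)) q (X q)) =ᶠ[𝓝 x]
        fun y => g.val y (nab Z y (X y)) (W y) + g.val y (Z y) (nab W y (X y)) := by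
      filter_upwards [hZ.eventually_vfdiffAt, hW.eventually_vfdiffAt] with y h1 h2
      exact h.metric y (X y) Z W h1 h2
    have h1 : mvfderiv I (fun q => mvfderiv I (fun y => g.val y (Z y) (W y)) q (X q)) x (η x)
        = mvfderiv I (fun y => g.val y (nab Z y (X y)) (W y) + g.val y (Z y) (nab W y (X y))) x
          (η x) :=
      congrArg (fun A => A (η x)) (this.mfderiv_eq (I := I) (I' := 𝓘(ℝ)))
    rw [h1, mvfderiv_fun_add (hd (hG hXZ hW)) (hd (hG hZ hXW))]
    rfl
  have m0 := h.metric x (mlieBracket I η X x) Z W hZ.vfdiffAt hW.vfdiffAt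
  have m1 := h.metric x (X x) _ W hηZ.vfdiffAt hW.vfdiffAt
  have m2 := h.metric x (X x) Z _ hZ.vfdiffAt hηW.vfdiffAt
  have k1 := lieTensor_apply g.smooth η hXZ.vfdiffAt hW.vfdiffAt
  have k2 := lieTensor_apply g.smooth η hZ.vfdiffAt hXW.vfdiffAt
  simp only [lieExpr] at k1 k2
  simp only [covExpr, lieDerivConnection, map_sub, sub_apply]
  linarith

/-- The Lie derivative of the Levi-Civita connection in terms of `K = £_η g`. -/
theorem two_mul_val_lieDerivConnection [I.Boundaryless] (h : IsLeviCivita g nab)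
    (hη : VFSmoothAt η x) (hX : VFSmoothAt X x) (hZ : VFSmoothAt Z x) (w : TangentSpace I x) :
    2 * g.val x w (lieDerivConnection η nab X Z x)
      = covDeriv₂ nab (fun x u v => lieTensor g.smooth η x u v) x (X x) (Z x) w
        + covDeriv₂ nab (fun x u v => lieTensor g.smooth η x u v) x (Z x) (X x) w
        - covDeriv₂ nab (fun x u v => lieTensor g.smooth η x u v) x w (X x) (Z x) := by
  have hW := vfsmoothAt_extend_self w
  have hK := smoothTensor₂At_lieTensor g.smooth hη
  have e1 := covDeriv₂_eq_covExpr nab hK (X x) hZ.vfdiffAt hW.vfdiffAt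
  have e2 := covDeriv₂_eq_covExpr nab hK (Z x) hX.vfdiffAt hW.vfdiffAt
  have e3 := covDeriv₂_eq_covExpr nab hK w hX.vfdiffAt hZ.vfdiffAt
  have d1 := h.covExpr_lieTensor hη hX hZ hW
  have d2 := h.covExpr_lieTensor hη hZ hX hW
  have d3 := h.covExpr_lieTensor hη hW hX hZ
  rw [FiberBundle.extend_apply_self] at e1 e2 d1 d2 d3
  -- Each derivative of `K` is a sum of two pairings with `Σ`. By the symmetry of `Σ`, four of the
  -- six cancel and the other two are both `g(w, Σ(X,Z))`.
  rw [e1, e2, e3, d1, d2, d3, h.lieDerivConnection_symm hη hZ hX,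
    h.lieDerivConnection_symm hη hW hX, h.lieDerivConnection_symm hη hW hZ,
    g.symm x w, g.symm x (Z x)]
  ring

end IsLeviCivita

end LeviCivita

/-! ### Identities for the null data and the hypersurface connection. -/

section Data

variable {E : Type*} [NormedAddCommGroup E] [NormedSpace ℝ E]
  {H : Type*} [TopologicalSpace H] {I : ModelWithCorners ℝ E H}
  {M : Type*} [TopologicalSpace M] [ChartedSpace H M]
  [FiniteDimensional ℝ E] [CompleteSpace E] [IsManifold I ∞ M]
  {x : M}

namespace NullMetricData

variable (D : NullMetricData I M)

theorem vfsmoothAt_n (x : M) : VFSmoothAt D.n x := D.smooth_n x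

theorem U_eq_lieTensor (x : M) (u v : TangentSpace I x) :
    D.U x u v = (1 / 2) * lieTensor D.smooth_γ D.n x u v := by
  rw [U, lieDeriv₂_eq_lieTensor]

theorem U_symm (x : M) (u v : TangentSpace I x) : D.U x u v = D.U x v u := by
  rw [U_eq_lieTensor, U_eq_lieTensor, lieTensor_symm D.smooth_γ D.symm_γ]

/-- Holds because `n` spans the radical of `γ`, so `γ(·,n)` vanishes identically, and `[n,n] = 0`.
-/
theorem U_n (x : M) (u : TangentSpace I x) : D.U x u (D.n x) = 0 := by
  have h := lieTensor_apply D.smooth_γ D.n (vfdiffAt_extend u) (D.vfdiffAt_n x)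
  have z : (fun y => D.γ y (FiberBundle.extend E u y) (D.n y)) = fun _ => 0 := by
    funext y; exact D.γ_n y _
  rw [lieExpr, z, mvfderiv_const, D.γ_n, mlieBracket_self, FiberBundle.extend_apply_self] at h
  rw [U_eq_lieTensor, h]
  simp

theorem mdifferentiableAt_U {X Z : Π x : M, TangentSpace I x} (hX : VFDiffAt X x)
    (hZ : VFDiffAt Z x) : MDifferentiableAt I 𝓘(ℝ) (fun y => D.U y (X y) (Z y)) x := by
  have h1 := (smoothTensor₂At_lieTensor D.smooth_γ (D.vfsmoothAt_n x)).mdiffAt hX hZ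
  have h2 : (fun y => D.U y (X y) (Z y))
      = fun y => (1 / 2) * lieTensor D.smooth_γ D.n y (X y) (Z y) := by
    funext y; exact D.U_eq_lieTensor y _ _
  rw [h2]
  exact mdifferentiableAt_const.mul h1

/-- The Lie derivative of `γ` along a multiple `α n` of `n` is `2 α U`. -/
theorem lieExpr_smul_n {α : M → ℝ} (hα : MDifferentiableAt I 𝓘(ℝ) α x)
    {X Z : Π x : M, TangentSpace I x} (hX : VFDiffAt X x) (hZ : VFDiffAt Z x) :
    lieExpr D.γ (α • D.n) X Z x = 2 * (α x * D.U x (X x) (Z x)) := by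
  rw [U_eq_lieTensor, lieTensor_apply D.smooth_γ D.n hX hZ]
  simp only [lieExpr, mlieBracket_smul_left hα (D.vfdiffAt_n x)]
  simp [D.γ_n, (D.n_spec x).1]
  ring

end NullMetricData

theorem isMetricHypersurfaceConnection_metricHypersurfaceConnection (D : NullMetricData I M) :
    IsMetricHypersurfaceConnection D (metricHypersurfaceConnection D) :=
  Classical.choose_spec (exists_isMetricHypersurfaceConnection D)

namespace IsMetricHypersurfaceConnection

variable {D : NullMetricData I M} {nab : CovariantDerivative I E (TangentSpace I : M → Type _)}
  {X Z W : Π x : M, TangentSpace I x}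

/-- The connection is not metric for `γ`: in the Koszul combination the six terms `ℓ U` prescribed
by `∇°γ` reduce, by symmetry of `U`, to the single correction with `ℓ` on the last slot. This
correction becomes the `ζ`-component in the Gauss formula. -/
theorem koszul_γ (h : IsMetricHypersurfaceConnection D nab) (hX : VFDiffAt X x)
    (hZ : VFDiffAt Z x) (hW : VFDiffAt W x) :
    koszul D.γ X Z W x
      = D.γ x (nab Z x (X x)) (W x) - D.U x (X x) (Z x) * D.ell x (W x) := by
  have m1 := h.deriv_γ x (X x) Z W hZ hW
  have m2 := h.deriv_γ x (Z x) X W hX hW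
  have m3 := h.deriv_γ x (W x) X Z hX hZ
  have t1 := h.torsion_free x X Z hX hZ
  have t2 := h.torsion_free x X W hX hW
  have t3 := h.torsion_free x Z W hZ hW
  rw [koszul, ← t1, ← t2, ← t3]
  rw [D.U_symm x (W x), D.U_symm x (W x), D.symm_γ x (X x) (nab Z x (W x))] at m3
  rw [D.U_symm x (Z x) (X x), D.symm_γ x (X x) (nab W x (Z x))] at m2
  rw [D.symm_γ x (Z x) (nab W x (X x))] at m1
  simp only [map_sub, sub_apply]
  linarith

theorem ell_nab (h : IsMetricHypersurfaceConnection D nab) (hX : VFDiffAt X x)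
    (hZ : VFDiffAt Z x) :
    D.ell x (nab Z x (X x)) = D.lamAux X Z x + D.ell2 x * D.U x (X x) (Z x) := by
  have h1 := h.deriv_ell x (X x) Z hZ
  have h2 := extDeriv₁_apply D.smooth_ell hX hZ
  rw [NullMetricData.F, h2] at h1
  rw [NullMetricData.lamAux]
  linarith

end IsMetricHypersurfaceConnection

end Data

/-! ### Geometry of the embedding and the Gauss formula. -/

section EmbeddedGeometry

variable {E : Type*} [NormedAddCommGroup E] [NormedSpace ℝ E]
  {H : Type*} [TopologicalSpace H] {I : ModelWithCorners ℝ E H}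
  {M : Type*} [TopologicalSpace M] [ChartedSpace H M]
  {E' : Type*} [NormedAddCommGroup E'] [NormedSpace ℝ E']
  {H' : Type*} [TopologicalSpace H'] {J : ModelWithCorners ℝ E' H'}
  {N : Type*} [TopologicalSpace N] [ChartedSpace H' N]
  [IsManifold I ∞ M] [IsManifold J ∞ N] [I.Boundaryless] [J.Boundaryless]
  [FiniteDimensional ℝ E] [CompleteSpace E] [FiniteDimensional ℝ E'] [CompleteSpace E']
  {φ : N → M}

theorem contMDiffAt_of_isSmoothEmbedding (hφ : Manifold.IsSmoothEmbedding J I ∞ φ) (q : N) :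
    ContMDiffAt J I ∞ φ q :=
  (hφ.isImmersion.isImmersionAt q).contMDiffAt

theorem mdifferentiableAt_of_isSmoothEmbedding (hφ : Manifold.IsSmoothEmbedding J I ∞ φ) (q : N) :
    MDifferentiableAt J I φ q :=
  (contMDiffAt_of_isSmoothEmbedding hφ q).mdifferentiableAt (by simp)

/-- A local retraction onto the hypersurface gives a left inverse of the derivative. -/
theorem mfderiv_injective (hφ : Manifold.IsSmoothEmbedding J I ∞ φ) (q : N) :
    Function.Injective (mfderiv J I φ q) := by
  obtain ⟨r, hr, hrφ⟩ := exists_localRetraction (hφ.isImmersion.isImmersionAt q)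
  have h1 : mfderiv J J (r ∘ φ) q = (mfderiv I J r (φ q)).comp (mfderiv J I φ q) :=
    mfderiv_comp q (hr.mdifferentiableAt (by simp)) (mdifferentiableAt_of_isSmoothEmbedding hφ q)
  have h2 : (r ∘ φ) =ᶠ[𝓝 q] id := hrφ
  have h3 : HasMFDerivAt J J (r ∘ φ) q (ContinuousLinearMap.id ℝ (TangentSpace J q)) :=
    (hasMFDerivAt_id q).congr_of_eventuallyEq h2
  intro u v huv
  have h4 : ∀ w : TangentSpace J q, mfderiv I J r (φ q) (mfderiv J I φ q w) = w := by
    intro w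
    have := congrArg (fun A => A w) (h1.symm.trans h3.mfderiv)
    exact this
  rw [← h4 u, ← h4 v, huv]

/-- `X` is a vector field on `M`, smooth at `φ q`, which is `φ`-related to `x` near `q`. -/
structure IsRelatedExtension (φ : N → M) (q : N) (x : Π p : N, TangentSpace J p)
    (X : Π y : M, TangentSpace I y) : Prop where
  smooth_source : VFSmoothAt x q
  smooth : VFSmoothAt X (φ q)
  eq_along : ∀ᶠ p in 𝓝 q, X (φ p) = mfderiv J I φ p (x p)

theorem exists_isRelatedExtension (hφ : Manifold.IsSmoothEmbedding J I ∞ φ) {q : N}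
    {x : Π p : N, TangentSpace J p} (hx : VFSmoothAt x q) :
    ∃ X : Π y : M, TangentSpace I y, IsRelatedExtension φ q x X := by
  obtain ⟨X, hX⟩ := exists_isLocalExtension (hφ.isImmersion.isImmersionAt q)
    (contMDiffAt_mfderiv_apply (contMDiffAt_of_isSmoothEmbedding hφ q) hx)
  exact ⟨X, hx, hX.smooth, hX.eq_along⟩

/-- Chain rule for a function on `M` restricting to a given function on `N`. -/
theorem mvfderiv_apply_mfderiv (hφ : Manifold.IsSmoothEmbedding J I ∞ φ) {q : N} {f : M → ℝ}
    (hf : MDifferentiableAt I 𝓘(ℝ) f (φ q)) {f' : N → ℝ} (h : ∀ᶠ p in 𝓝 q, f (φ p) = f' p)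
    (u : TangentSpace J q) :
    mvfderiv I f (φ q) (mfderiv J I φ q u) = mvfderiv J f' q u := by
  have h1 := mfderiv_comp_apply q hf (mdifferentiableAt_of_isSmoothEmbedding hφ q) u
  have h2 : f ∘ φ =ᶠ[𝓝 q] f' := h
  have h3 := congrArg (fun A => A u) (h2.mfderiv_eq (I := J) (I' := 𝓘(ℝ)))
  exact h1.symm.trans h3

theorem IsRelatedExtension.mlieBracket (hφ : Manifold.IsSmoothEmbedding J I ∞ φ) {q : N}
    {x z : Π p : N, TangentSpace J p} {X Z : Π y : M, TangentSpace I y}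
    (hX : IsRelatedExtension φ q x X) (hZ : IsRelatedExtension φ q z Z) :
    mlieBracket I X Z (φ q) = mfderiv J I φ q (mlieBracket J x z q) :=
  mlieBracket_of_related (contMDiffAt_of_isSmoothEmbedding hφ q) hX.smooth hZ.smooth
    hX.smooth_source hZ.smooth_source hX.eq_along hZ.eq_along

theorem isLocalExtension_localExtension (hφ : Manifold.IsSmoothEmbedding J I ∞ φ)
    (ζ : Rigging I J φ) (q : N) :
    IsLocalExtension φ ζ.field q (localExtension hφ ζ q) :=
  Classical.choose_spec (exists_isLocalExtension (hφ.isImmersion.isImmersionAt q) (ζ.smooth q))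

/-- The rigging and the tangent space of the hypersurface span the ambient tangent space. -/
theorem exists_rigging_decomposition (hφ : Manifold.IsSmoothEmbedding J I ∞ φ)
    (ζ : Rigging I J φ) (hdim : Module.finrank ℝ E = Module.finrank ℝ E' + 1) (q : N)
    (w : TangentSpace I (φ q)) :
    ∃ (b : ℝ) (u : TangentSpace J q), w = b • ζ.field q + mfderiv J I φ q u := by
  let L : (ℝ × TangentSpace J q) →ₗ[ℝ] TangentSpace I (φ q) :=
    (LinearMap.toSpanSingleton ℝ (TangentSpace I (φ q)) (ζ.field q)).coprod
      (mfderiv J I φ q).toLinearMap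
  have hL : ∀ b u, L (b, u) = b • ζ.field q + mfderiv J I φ q u := fun b u => by
    simp [L]
  have hinj : Function.Injective L := by
    rw [← LinearMap.ker_eq_bot, LinearMap.ker_eq_bot']
    rintro ⟨b, u⟩ hbu
    rw [hL] at hbu
    have hb : b = 0 := by
      by_contra hb
      refine ζ.transverse q ⟨-(b⁻¹ • u), ?_⟩
      have : mfderiv J I φ q u = -(b • ζ.field q) := by
        rw [eq_neg_iff_add_eq_zero, add_comm]; exact hbu
      rw [map_neg, map_smul, this, smul_neg, neg_neg, smul_smul, inv_mul_cancel₀ hb, one_smul]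
    subst hb
    rw [zero_smul, zero_add] at hbu
    have : u = 0 := mfderiv_injective hφ q (by rw [hbu, map_zero])
    rw [this]
    rfl
  have hfr : Module.finrank ℝ (ℝ × TangentSpace J q) = Module.finrank ℝ (TangentSpace I (φ q)) := by
    rw [Module.finrank_prod, Module.finrank_self]
    change 1 + Module.finrank ℝ E' = Module.finrank ℝ E
    omega
  obtain ⟨⟨b, u⟩, h⟩ := (LinearMap.injective_iff_surjective_of_finrank_eq_finrank hfr).1 hinj w
  exact ⟨b, u, by rw [← hL, h]⟩

variable {g : LorentzianMetric I M} {D : NullHypersurfaceData J N}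
  {hφ : Manifold.IsSmoothEmbedding J I ∞ φ} {ζ : Rigging I J φ}

/-- Ambient vectors are determined by their products with the rigging and tangent vectors. -/
theorem LorentzianMetric.eq_of_val_eq (g : LorentzianMetric I M)
    (hφ : Manifold.IsSmoothEmbedding J I ∞ φ)
    (ζ : Rigging I J φ) (hdim : Module.finrank ℝ E = Module.finrank ℝ E' + 1) (q : N)
    {v w : TangentSpace I (φ q)} (h1 : g.val (φ q) v (ζ.field q) = g.val (φ q) w (ζ.field q))
    (h2 : ∀ u : TangentSpace J q, g.val (φ q) v (mfderiv J I φ q u)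
      = g.val (φ q) w (mfderiv J I φ q u)) : v = w := by
  refine sub_eq_zero.1 (g.eq_zero (φ q) _ fun y => ?_)
  obtain ⟨b, u, rfl⟩ := exists_rigging_decomposition hφ ζ hdim q y
  rw [map_sub, sub_apply, map_add, map_add, map_smul, map_smul, h1, h2, sub_self]

namespace NullHypersurfaceData.IsEmbedded

variable {nab : CovariantDerivative I E (TangentSpace I : M → Type _)}
  {nab₀ : CovariantDerivative J E' (TangentSpace J : N → Type _)}
  {q : N} {x z w : Π p : N, TangentSpace J p} {X Z W : Π y : M, TangentSpace I y}

theorem val_eventuallyEq (hD : D.IsEmbedded g hφ ζ) (hX : IsRelatedExtension φ q x X)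
    (hZ : IsRelatedExtension φ q z Z) :
    ∀ᶠ p in 𝓝 q, g.val (φ p) (X (φ p)) (Z (φ p)) = D.γ p (x p) (z p) := by
  filter_upwards [hX.eq_along, hZ.eq_along] with p h1 h2
  rw [h1, h2, hD.γ_eq]

theorem val_rigging_eventuallyEq (hD : D.IsEmbedded g hφ ζ) (hX : IsRelatedExtension φ q x X) :
    ∀ᶠ p in 𝓝 q, g.val (φ p) (X (φ p)) (localExtension hφ ζ q (φ p)) = D.ell p (x p) := by
  filter_upwards [hX.eq_along, (isLocalExtension_localExtension hφ ζ q).eq_along] with p h1 h2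
  rw [h1, h2, g.symm, hD.ell_eq]

theorem mvfderiv_val (hD : D.IsEmbedded g hφ ζ) (hX : IsRelatedExtension φ q x X)
    (hZ : IsRelatedExtension φ q z Z) (u : TangentSpace J q) :
    mvfderiv I (fun y => g.val y (X y) (Z y)) (φ q) (mfderiv J I φ q u)
      = mvfderiv J (fun p => D.γ p (x p) (z p)) q u :=
  mvfderiv_apply_mfderiv hφ (g.smooth.mdiffAt hX.smooth.vfdiffAt hZ.smooth.vfdiffAt)
    (hD.val_eventuallyEq hX hZ) u

/-- For fields tangent to the hypersurface, every derivative and bracket in the Koszul expression is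
tangential and hence intrinsic. -/
theorem koszul_tangent (hD : D.IsEmbedded g hφ ζ) (hX : IsRelatedExtension φ q x X)
    (hZ : IsRelatedExtension φ q z Z) (hW : IsRelatedExtension φ q w W) :
    koszul g.val X Z W (φ q) = koszul D.γ x z w q := by
  rw [koszul, koszul, hX.mlieBracket hφ hZ, hX.mlieBracket hφ hW, hZ.mlieBracket hφ hW,
    hX.eq_along.self_of_nhds, hZ.eq_along.self_of_nhds, hW.eq_along.self_of_nhds,
    hD.mvfderiv_val hX hZ, hD.mvfderiv_val hX hW, hD.mvfderiv_val hZ hW,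
    hD.γ_eq, hD.γ_eq, hD.γ_eq]

/-- The only transverse derivative is that of `g(X,Z)` along the rigging. Trading it for `£_ζ g =
2Y` leaves derivatives of `ℓ` along the hypersurface and one bracket, which together are `lamAux`.
-/
theorem koszul_rigging (hD : D.IsEmbedded g hφ ζ) (hX : IsRelatedExtension φ q x X)
    (hZ : IsRelatedExtension φ q z Z) :
    koszul g.val X Z (localExtension hφ ζ q) (φ q)
      = D.lamAux x z q - D.Y q (x q) (z q) := by
  set R := localExtension hφ ζ q with hR
  have hRe := isLocalExtension_localExtension hφ ζ q
  have hRs : VFSmoothAt R (φ q) := hRe.smooth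
  have hRq : R (φ q) = ζ.field q := hRe.eq_along.self_of_nhds
  have hL := lieDeriv₂_eq_lieExpr (g.smooth (φ q)) R hX.smooth.vfdiffAt hZ.smooth.vfdiffAt
  have hY := hD.Y_eq q (x q) (z q)
  have d1 := mvfderiv_apply_mfderiv hφ
    (g.smooth.mdiffAt hZ.smooth.vfdiffAt hRs.vfdiffAt) (hD.val_rigging_eventuallyEq hZ) (x q)
  have d2 := mvfderiv_apply_mfderiv hφ
    (g.smooth.mdiffAt hX.smooth.vfdiffAt hRs.vfdiffAt) (hD.val_rigging_eventuallyEq hX) (z q)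
  rw [pullbackLieRigging, ← hX.eq_along.self_of_nhds, ← hZ.eq_along.self_of_nhds, ← hR, hL] at hY
  rw [lieExpr, mlieBracket_swap_apply (V := R) (W := X),
    mlieBracket_swap_apply (V := R) (W := Z), g.symm _ (X (φ q))] at hY
  rw [← hX.eq_along.self_of_nhds] at d1
  rw [← hZ.eq_along.self_of_nhds] at d2
  have hb : g.val (φ q) (mlieBracket I X Z (φ q)) (R (φ q)) = D.ell q (mlieBracket J x z q) := by
    rw [hX.mlieBracket hφ hZ, hRq, g.symm, hD.ell_eq]
  simp only [map_neg, neg_apply] at hY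
  rw [koszul, NullMetricData.lamAux, d1, d2, hb, ← hY]
  ring

/-- The decomposition of the ambient connection along tangential vector fields. -/
theorem gauss (hD : D.IsEmbedded g hφ ζ)
    (hdim : Module.finrank ℝ E = Module.finrank ℝ E' + 1) (h : IsLeviCivita g nab)
    (h₀ : IsMetricHypersurfaceConnection D.toNullMetricData nab₀)
    (hX : IsRelatedExtension φ q x X) (hZ : IsRelatedExtension φ q z Z) :
    nab Z (φ q) (X (φ q)) = mfderiv J I φ q (nab₀ z q (x q))
      - D.Y q (x q) (z q) • mfderiv J I φ q (D.n q) - D.U q (x q) (z q) • ζ.field q := by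
  have hRe := isLocalExtension_localExtension hφ ζ q
  have hRs : VFSmoothAt (localExtension hφ ζ q) (φ q) := hRe.smooth
  refine g.eq_of_val_eq hφ ζ hdim q ?_ fun u => ?_
  -- Contraction with the rigging: the `ℓ⁽²⁾ U` in `∇°ℓ` is exactly compensated by `g(ζ,ζ) = ℓ⁽²⁾`
  -- in the transverse part.
  · have e1 := h.koszul_formula hX.smooth.vfdiffAt hZ.smooth.vfdiffAt hRs.vfdiffAt
    rw [hD.koszul_rigging hX hZ, hRe.eq_along.self_of_nhds] at e1
    have e2 := h₀.ell_nab hX.smooth_source.vfdiffAt hZ.smooth_source.vfdiffAt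
    rw [e1]
    simp only [map_sub, map_smul, sub_apply, smul_apply, smul_eq_mul]
    rw [g.symm _ (mfderiv J I φ q _), g.symm _ (mfderiv J I φ q (D.n q)), hD.ell_eq, hD.ell_eq,
      hD.ell2_eq, (D.n_spec q).2, e2]
    ring
  -- Contraction with a tangent vector: `n` contributes nothing, being in the radical of `γ`, and
  -- `ζ` contributes `U ℓ`.
  · obtain ⟨W, hW⟩ := exists_isRelatedExtension hφ (vfsmoothAt_extend_self (I := J) u)
    have e1 := h.koszul_formula hX.smooth.vfdiffAt hZ.smooth.vfdiffAt hW.smooth.vfdiffAt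
    rw [hD.koszul_tangent hX hZ hW, h₀.koszul_γ hX.smooth_source.vfdiffAt
      hZ.smooth_source.vfdiffAt hW.smooth_source.vfdiffAt, hW.eq_along.self_of_nhds,
      FiberBundle.extend_apply_self] at e1
    rw [e1]
    simp only [map_sub, map_smul, sub_apply, smul_apply, smul_eq_mul]
    rw [hD.γ_eq, hD.γ_eq, hD.ell_eq, (D.n_spec q).1]
    ring

end NullHypersurfaceData.IsEmbedded

end EmbeddedGeometry

/-! ### The deformation tensor of a null tangent field along the hypersurface. -/

section Deformation

variable {E : Type*} [NormedAddCommGroup E] [NormedSpace ℝ E]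
  {H : Type*} [TopologicalSpace H] {I : ModelWithCorners ℝ E H}
  {M : Type*} [TopologicalSpace M] [ChartedSpace H M]
  {E' : Type*} [NormedAddCommGroup E'] [NormedSpace ℝ E']
  {H' : Type*} [TopologicalSpace H'] {J : ModelWithCorners ℝ E' H'}
  {N : Type*} [TopologicalSpace N] [ChartedSpace H' N]
  [IsManifold I ∞ M] [IsManifold J ∞ N] [I.Boundaryless] [J.Boundaryless]
  [FiniteDimensional ℝ E] [CompleteSpace E] [FiniteDimensional ℝ E'] [CompleteSpace E']
  {φ : N → M} {g : LorentzianMetric I M} {D : NullHypersurfaceData J N}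
  {hφ : Manifold.IsSmoothEmbedding J I ∞ φ} {ζ : Rigging I J φ}
  {η : Π y : M, TangentSpace I y} {α : N → ℝ}
  {nab : CovariantDerivative I E (TangentSpace I : M → Type _)}
  {nab₀ : CovariantDerivative J E' (TangentSpace J : N → Type _)} {q : N}

theorem deformationTensor_eq_lieTensor (g : LorentzianMetric I M)
    (η : Π y : M, TangentSpace I y) :
    deformationTensor g η = fun y u v => lieTensor g.smooth η y u v := by
  funext y u v
  exact lieDeriv₂_eq_lieTensor g.smooth η u v

theorem qCovector_eq (ζ : Rigging I J φ) (g : LorentzianMetric I M)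
    (η : Π y : M, TangentSpace I y) (q : N) (u : TangentSpace J q) :
    qCovector ζ g η q u = lieTensor g.smooth η (φ q) (ζ.field q) (mfderiv J I φ q u) :=
  lieDeriv₂_eq_lieTensor g.smooth η _ _

theorem wScalar_eq (D : NullMetricData J N) (ζ : Rigging I J φ) (g : LorentzianMetric I M)
    (η : Π y : M, TangentSpace I y) (q : N) :
    wScalar D ζ g η q = lieTensor g.smooth η (φ q) (ζ.field q) (mfderiv J I φ q (D.n q)) :=
  lieDeriv₂_eq_lieTensor g.smooth η _ _

theorem pScalar_eq (ζ : Rigging I J φ) (g : LorentzianMetric I M)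
    (η : Π y : M, TangentSpace I y) (q : N) :
    pScalar ζ g η q = lieTensor g.smooth η (φ q) (ζ.field q) (ζ.field q) :=
  lieDeriv₂_eq_lieTensor g.smooth η _ _

/-- `η` is smooth along `φ(N)`, where it equals `α φ_* n` with `α` smooth. -/
structure IsNullTangent (D : NullHypersurfaceData J N) (φ : N → M) (η : Π y : M, TangentSpace I y)
    (α : N → ℝ) : Prop where
  smooth : ∀ q, VFSmoothAt η (φ q)
  smooth_coeff : ContMDiff J 𝓘(ℝ) ∞ α
  eq_along : ∀ q, η (φ q) = α q • mfderiv J I φ q (D.n q)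

namespace IsNullTangent

theorem isRelatedExtension (h : IsNullTangent D φ η α) (q : N) :
    IsRelatedExtension φ q (α • D.n) η where
  smooth_source := ContMDiffAt.smul_section (h.smooth_coeff q) (D.smooth_n q)
  smooth := h.smooth q
  eq_along := Filter.Eventually.of_forall fun p => by
    rw [h.eq_along p, Pi.smul_apply', map_smul]

/-- Since `η` is `φ`-related to `αn`, the form `£_η g` pulls back to `£_{αn} γ`; no derivative of
`α` appears because `γ(n,·) = 0`. -/
theorem lieTensor_tangent (h : IsNullTangent D φ η α) (hD : D.IsEmbedded g hφ ζ) (q : N)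
    (u v : TangentSpace J q) :
    lieTensor g.smooth η (φ q) (mfderiv J I φ q u) (mfderiv J I φ q v)
      = 2 * (α q * D.U q u v) := by
  obtain ⟨X, hX⟩ := exists_isRelatedExtension hφ (vfsmoothAt_extend_self (I := J) u)
  obtain ⟨Z, hZ⟩ := exists_isRelatedExtension hφ (vfsmoothAt_extend_self (I := J) v)
  have hη := h.isRelatedExtension q
  have e1 := lieTensor_apply g.smooth η hX.smooth.vfdiffAt hZ.smooth.vfdiffAt
  have e2 := D.lieExpr_smul_n ((h.smooth_coeff q).mdifferentiableAt (by simp))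
    hX.smooth_source.vfdiffAt hZ.smooth_source.vfdiffAt
  rw [lieExpr, hη.mlieBracket hφ hX, hη.mlieBracket hφ hZ,
    hX.eq_along.self_of_nhds, hZ.eq_along.self_of_nhds, hη.eq_along.self_of_nhds,
    hD.mvfderiv_val hX hZ, hD.γ_eq, hD.γ_eq] at e1
  rw [lieExpr] at e2
  rw [FiberBundle.extend_apply_self, FiberBundle.extend_apply_self] at e1 e2
  rw [e1, e2]

theorem lieTensor_n (h : IsNullTangent D φ η α) (hD : D.IsEmbedded g hφ ζ) (q : N)
    (u : TangentSpace J q) :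
    lieTensor g.smooth η (φ q) (mfderiv J I φ q (D.n q)) (mfderiv J I φ q u) = 0 := by
  rw [h.lieTensor_tangent hD, D.U_symm, D.U_n]
  simp

/-- The covariant derivative of `£_η g` in tangential directions. -/
theorem covDeriv₂_lieTensor_tangent (h : IsNullTangent D φ η α) (hD : D.IsEmbedded g hφ ζ)
    (hdim : Module.finrank ℝ E = Module.finrank ℝ E' + 1) (hL : IsLeviCivita g nab)
    (h₀ : IsMetricHypersurfaceConnection D.toNullMetricData nab₀)
    (u v w : TangentSpace J q) :
    covDeriv₂ nab (fun x u v => lieTensor g.smooth η x u v) (φ q) (mfderiv J I φ q u)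
        (mfderiv J I φ q v) (mfderiv J I φ q w)
      = 2 * (mvfderiv J α q u * D.U q v w + α q * covDeriv₂ nab₀ D.U q u v w)
        + D.U q u v * qCovector ζ g η q w + D.U q u w * qCovector ζ g η q v := by
  obtain ⟨X, hX⟩ := exists_isRelatedExtension hφ (vfsmoothAt_extend_self (I := J) u)
  obtain ⟨Z, hZ⟩ := exists_isRelatedExtension hφ (vfsmoothAt_extend_self (I := J) v)
  obtain ⟨W, hW⟩ := exists_isRelatedExtension hφ (vfsmoothAt_extend_self (I := J) w)
  have hK := smoothTensor₂At_lieTensor g.smooth (h.smooth q)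
  have hKs := fun a b => lieTensor_symm (x := φ q) g.smooth g.symm η a b
  have e1 := covDeriv₂_eq_covExpr nab hK (X (φ q)) hZ.smooth.vfdiffAt hW.smooth.vfdiffAt
  have g1 := hD.gauss hdim hL h₀ hX hZ
  have g2 := hD.gauss hdim hL h₀ hX hW
  rw [covExpr, g1, g2, hX.eq_along.self_of_nhds, hZ.eq_along.self_of_nhds,
    hW.eq_along.self_of_nhds] at e1
  have d1 := mvfderiv_apply_mfderiv hφ
    (hK.mdiffAt hZ.smooth.vfdiffAt hW.smooth.vfdiffAt)
    (f' := fun p => 2 * (α p * D.U p (FiberBundle.extend E' v p) (FiberBundle.extend E' w p))) (by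
      filter_upwards [hZ.eq_along, hW.eq_along] with p h1 h2
      rw [h1, h2, h.lieTensor_tangent hD]) u
  have hα : MDifferentiableAt J 𝓘(ℝ) α q := (h.smooth_coeff q).mdifferentiableAt (by simp)
  have hU := D.mdifferentiableAt_U (vfdiffAt_extend (I := J) v) (vfdiffAt_extend (I := J) w)
  have hαU : MDifferentiableAt J 𝓘(ℝ)
      (fun p => α p * D.U p (FiberBundle.extend E' v p) (FiberBundle.extend E' w p)) q := hα.mul hU
  rw [mvfderiv_fun_mul mdifferentiableAt_const hαU, mvfderiv_fun_mul hα hU] at d1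
  simp only [FiberBundle.extend_apply_self] at e1 d1
  rw [e1, d1]
  simp only [map_sub, map_smul, sub_apply, smul_apply, add_apply, smul_eq_mul, mvfderiv_const]
  -- In the Gauss terms the `Y n` part is annihilated since `K(n,·) = 0` on tangent vectors, and the
  -- `U ζ` part produces the products of `U` and `q`.
  rw [hKs (mfderiv J I φ q v) (mfderiv J I φ q (D.n q)), hKs (mfderiv J I φ q v) (ζ.field q),
    h.lieTensor_n hD, h.lieTensor_n hD, h.lieTensor_tangent hD, h.lieTensor_tangent hD,
    ← qCovector_eq, ← qCovector_eq, covDeriv₂]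
  simp
  ring

/-- All three derivatives of `K` are tangential. In their alternating sum the terms `U q` with `q`
evaluated on `u` or `v` cancel, and those with `q` evaluated on `w` add up. -/
theorem val_tangent (h : IsNullTangent D φ η α) (hD : D.IsEmbedded g hφ ζ)
    (hdim : Module.finrank ℝ E = Module.finrank ℝ E' + 1) (hL : IsLeviCivita g nab)
    (h₀ : IsMetricHypersurfaceConnection D.toNullMetricData nab₀)
    (u v w : TangentSpace J q) {X Z : Π y : M, TangentSpace I y} (hX : VFSmoothAt X (φ q))
    (hZ : VFSmoothAt Z (φ q)) (hXu : X (φ q) = mfderiv J I φ q u)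
    (hZv : Z (φ q) = mfderiv J I φ q v) :
    g.val (φ q) (mfderiv J I φ q w) (lieDerivConnection η nab X Z (φ q))
      = mvfderiv J α q u * D.U q v w + mvfderiv J α q v * D.U q u w
        + D.U q u v * (qCovector ζ g η q w - mvfderiv J α q w)
        + α q * (covDeriv₂ nab₀ D.U q u v w + covDeriv₂ nab₀ D.U q v u w
          - covDeriv₂ nab₀ D.U q w u v) := by
  have e := hL.two_mul_val_lieDerivConnection (h.smooth q) hX hZ (mfderiv J I φ q w)
  rw [hXu, hZv, h.covDeriv₂_lieTensor_tangent hD hdim hL h₀,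
    h.covDeriv₂_lieTensor_tangent hD hdim hL h₀, h.covDeriv₂_lieTensor_tangent hD hdim hL h₀,
    D.U_symm q v u, D.U_symm q w u, D.U_symm q w v] at e
  linarith

/-- Two derivatives are tangential and see only `K(ζ,·)`; the third is transverse and is expressed
by `£_ζ K`. No property of `∇_u ζ` and `∇_v ζ` is needed, since they cancel. -/
theorem val_rigging (h : IsNullTangent D φ η α) (hD : D.IsEmbedded g hφ ζ)
    (hdim : Module.finrank ℝ E = Module.finrank ℝ E' + 1) (hL : IsLeviCivita g nab)
    (u v : TangentSpace J q) {X Z : Π y : M, TangentSpace I y} (hX : VFSmoothAt X (φ q))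
    (hZ : VFSmoothAt Z (φ q)) (hXu : X (φ q) = mfderiv J I φ q u)
    (hZv : Z (φ q) = mfderiv J I φ q v) :
    g.val (φ q) (ζ.field q) (lieDerivConnection η nab X Z (φ q))
      = bTensor D hφ ζ g η q u v := by
  have h₀ := isMetricHypersurfaceConnection_metricHypersurfaceConnection D.toNullMetricData
  have e := hL.two_mul_val_lieDerivConnection (h.smooth q) hX hZ (ζ.field q)
  obtain ⟨A, hA⟩ := exists_isRelatedExtension hφ (vfsmoothAt_extend_self (I := J) u)
  obtain ⟨B, hB⟩ := exists_isRelatedExtension hφ (vfsmoothAt_extend_self (I := J) v)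
  set R := localExtension hφ ζ q with hR
  have hRe : IsLocalExtension φ ζ.field q R := isLocalExtension_localExtension hφ ζ q
  have hRs : VFSmoothAt R (φ q) := hRe.smooth
  have hRq : R (φ q) = ζ.field q := hRe.eq_along.self_of_nhds
  have hAq : A (φ q) = mfderiv J I φ q u := by
    rw [hA.eq_along.self_of_nhds, FiberBundle.extend_apply_self]
  have hBq : B (φ q) = mfderiv J I φ q v := by
    rw [hB.eq_along.self_of_nhds, FiberBundle.extend_apply_self]
  have hK := smoothTensor₂At_lieTensor g.smooth (h.smooth q)
  have hKs := fun a b => lieTensor_symm (x := φ q) g.smooth g.symm η a b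
  -- Along the hypersurface `K(S,R)` is the function `q(s)`, so its tangential derivatives are those
  -- of the covector `q`.
  have hq : ∀ (s : TangentSpace J q) (S : Π y : M, TangentSpace I y),
      IsRelatedExtension φ q (FiberBundle.extend E' s) S → ∀ t : TangentSpace J q,
      mvfderiv I (fun y => lieTensor g.smooth η y (S y) (R y)) (φ q) (mfderiv J I φ q t)
        = mvfderiv J (fun p => qCovector ζ g η p (FiberBundle.extend E' s p)) q t := by
    intro s S hS t
    refine mvfderiv_apply_mfderiv hφ (hK.mdiffAt hS.smooth.vfdiffAt hRs.vfdiffAt) ?_ t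
    filter_upwards [hS.eq_along, hRe.eq_along] with p h1 h2
    rw [h1, h2, lieTensor_symm g.smooth g.symm, qCovector_eq]
  have c1 := covDeriv₂_eq_covExpr nab hK (A (φ q)) hB.smooth.vfdiffAt hRs.vfdiffAt
  have c2 := covDeriv₂_eq_covExpr nab hK (B (φ q)) hA.smooth.vfdiffAt hRs.vfdiffAt
  have c3 := covDeriv₂_eq_covExpr nab hK (R (φ q)) hA.smooth.vfdiffAt hB.smooth.vfdiffAt
  have g1 := hD.gauss hdim hL h₀ hA hB
  have g2 := hD.gauss hdim hL h₀ hB hA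
  have l1 := lieDeriv₂_eq_lieExpr hK R hA.smooth.vfdiffAt hB.smooth.vfdiffAt
  have t1 := hL.torsion_free (φ q) R A hRs.vfdiffAt hA.smooth.vfdiffAt
  have t2 := hL.torsion_free (φ q) R B hRs.vfdiffAt hB.smooth.vfdiffAt
  simp only [covExpr] at c1 c2 c3
  -- Writing `[R,A] = ∇_R A - ∇_A R` shows that `£_R K` differs from `∇_R K` by the terms `K(∇_A R,
  -- B)` and `K(A, ∇_B R)` only.
  rw [lieExpr, ← t1, ← t2] at l1
  simp only [FiberBundle.extend_apply_self] at g1 g2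
  rw [g1] at c1
  rw [g2] at c2
  rw [hAq, hBq, hRq] at c1 c2 c3 l1
  rw [hq v B hB u] at c1
  rw [hq u A hA v] at c2
  rw [hXu, hZv, c1, c2, c3] at e
  rw [bTensor, iTensor, pullbackLieRigging, deformationTensor_eq_lieTensor, ← hR, l1,
    wScalar_eq, pScalar_eq, covDeriv₁, covDeriv₁, qCovector_eq ζ g η q
      (metricHypersurfaceConnection _ _ _ _), qCovector_eq ζ g η q
      (metricHypersurfaceConnection _ _ _ _)]
  simp only [map_sub, map_smul, sub_apply, smul_apply, smul_eq_mul] at e ⊢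
  have k0 := fun a : TangentSpace J q => hKs (mfderiv J I φ q a) (ζ.field q)
  rw [D.symm_Y q v u, D.U_symm q v u] at e
  simp only [k0] at e
  -- The derivatives of the rigging occur with the slots of `K` in opposite orders; symmetry of `K`
  -- makes them cancel.
  have k1 := hKs (nab R (φ q) (mfderiv J I φ q u)) (mfderiv J I φ q v)
  have k2 := hKs (nab R (φ q) (mfderiv J I φ q v)) (mfderiv J I φ q u)
  linarith

end IsNullTangent

end Deformation

/-! ### The coefficient of a null tangent field and the splitting of fields along the hypersurface.
-/

section Decomposition

variable {E : Type*} [NormedAddCommGroup E] [NormedSpace ℝ E]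
  {H : Type*} [TopologicalSpace H] {I : ModelWithCorners ℝ E H}
  {M : Type*} [TopologicalSpace M] [ChartedSpace H M]
  {E' : Type*} [NormedAddCommGroup E'] [NormedSpace ℝ E']
  {H' : Type*} [TopologicalSpace H'] {J : ModelWithCorners ℝ E' H'}
  {N : Type*} [TopologicalSpace N] [ChartedSpace H' N]
  [IsManifold I ∞ M] [IsManifold J ∞ N] [I.Boundaryless] [J.Boundaryless]
  [FiniteDimensional ℝ E] [CompleteSpace E] [FiniteDimensional ℝ E'] [CompleteSpace E']
  {φ : N → M} {g : LorentzianMetric I M} {D : NullHypersurfaceData J N}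
  {hφ : Manifold.IsSmoothEmbedding J I ∞ φ} {ζ : Rigging I J φ}

/-- Null vectors of `γ` are multiples of `n`. -/
theorem NullMetricData.eq_smul_n (D : NullMetricData J N) (q : N) (u : TangentSpace J q)
    (hu : D.γ q u u = 0) : u = D.ell q u • D.n q := by
  have h1 : ∀ v, D.γ q u v = 0 := by
    intro v
    by_contra hv
    -- As `γ(u,u) = 0`, the nonnegative function `γ(v + tu, v + tu)` is affine in `t`, so its slope
    -- must vanish.
    have h2 : ∀ t : ℝ, 0 ≤ D.γ q v v + 2 * t * D.γ q u v := by
      intro t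
      have h3 := D.nonneg_γ q (v + t • u)
      simp only [map_add, map_smul, add_apply, smul_apply, smul_eq_mul, hu,
        D.symm_γ q v u] at h3
      linarith
    -- This value of `t` makes the affine function equal to `-1`.
    have h4 := h2 (-(D.γ q v v + 1) / (2 * D.γ q u v))
    have h5 : 2 * (-(D.γ q v v + 1) / (2 * D.γ q u v)) * D.γ q u v = -(D.γ q v v + 1) := by
      field_simp
    linarith
  refine sub_eq_zero.1 (D.eq_zero q _ (fun v => ?_) ?_)
  · simp [h1, (D.n_spec q).1]
  · simp [(D.n_spec q).2]

theorem contMDiffAt_val_comp (hφ : Manifold.IsSmoothEmbedding J I ∞ φ) (g : LorentzianMetric I M)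
    {q : N} {X Z : Π y : M, TangentSpace I y} (hX : VFSmoothAt X (φ q))
    (hZ : VFSmoothAt Z (φ q)) :
    ContMDiffAt J 𝓘(ℝ) ∞ (fun p => g.val (φ p) (X (φ p)) (Z (φ p))) q :=
  (SmoothTensor₂At.contMDiffAt (g.smooth (φ q)) hX hZ).comp q (contMDiffAt_of_isSmoothEmbedding hφ q)

/-- The product of two smooth vector fields along `φ` is smooth. -/
theorem contMDiffAt_val_along (hφ : Manifold.IsSmoothEmbedding J I ∞ φ) (g : LorentzianMetric I M)
    {q : N} {V W : Π q : N, TangentSpace I (φ q)}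
    (hV : ContMDiffAt J I.tangent ∞ (fun q => (⟨φ q, V q⟩ : TangentBundle I M)) q)
    (hW : ContMDiffAt J I.tangent ∞ (fun q => (⟨φ q, W q⟩ : TangentBundle I M)) q) :
    ContMDiffAt J 𝓘(ℝ) ∞ (fun p => g.val (φ p) (V p) (W p)) q := by
  obtain ⟨X, hX⟩ := exists_isLocalExtension (hφ.isImmersion.isImmersionAt q) hV
  obtain ⟨Z, hZ⟩ := exists_isLocalExtension (hφ.isImmersion.isImmersionAt q) hW
  refine (contMDiffAt_val_comp hφ g hX.smooth hZ.smooth).congr_of_eventuallyEq ?_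
  filter_upwards [hX.eq_along, hZ.eq_along] with p h1 h2
  rw [h1, h2]

theorem exists_isNullTangent (hD : D.IsEmbedded g hφ ζ) {η : Π y : M, TangentSpace I y}
    (hη : ∀ q, VFSmoothAt η (φ q)) (htangent : ∀ q : N, η (φ q) ∈ Set.range (mfderiv J I φ q))
    (hnull : ∀ q : N, g.val (φ q) (η (φ q)) (η (φ q)) = 0) :
    ∃ α : N → ℝ, IsNullTangent D φ η α := by
  -- Pairing `η = α n` with the rigging recovers `α`, because `ℓ(n) = 1`; this formula also shows
  -- smoothness.
  refine ⟨fun q => g.val (φ q) (ζ.field q) (η (φ q)), hη, fun q => ?_, fun q => ?_⟩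
  · exact contMDiffAt_val_along hφ g (ζ.smooth q)
      (ContMDiffAt.comp q (hη q) (contMDiffAt_of_isSmoothEmbedding hφ q))
  · obtain ⟨u, hu⟩ := htangent q
    have h0 := hnull q
    rw [← hu, hD.γ_eq] at h0
    have h1 := D.eq_smul_n q u h0
    rw [← hu, hD.ell_eq, ← map_smul, ← h1]

/-- A smooth vector field along `φ` has smooth components transverse and tangent to `φ(N)`. -/
theorem exists_smooth_decomposition (hD : D.IsEmbedded g hφ ζ)
    (hdim : Module.finrank ℝ E = Module.finrank ℝ E' + 1) (W : Π q : N, TangentSpace I (φ q))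
    (hW : ContMDiff J I.tangent ∞ (fun q => (⟨φ q, W q⟩ : TangentBundle I M))) :
    ∃ (β : N → ℝ) (Wbar : Π q : N, TangentSpace J q),
      ContMDiff J 𝓘(ℝ) ∞ β ∧
      ContMDiff J J.tangent ∞ (fun q => (⟨q, Wbar q⟩ : TangentBundle J N)) ∧
      ∀ q : N, W q = β q • ζ.field q + mfderiv J I φ q (Wbar q) := by
  choose β Wbar hβ using fun q => exists_rigging_decomposition hφ ζ hdim q (W q)
  have hs := fun q => contMDiffAt_of_isSmoothEmbedding hφ q
  have hβs : ∀ q, ContMDiffAt J 𝓘(ℝ) ∞ β q := by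
    intro q
    -- The transverse component is `β = g(W, n)`: tangent vectors are orthogonal to `n`, and `g(ζ,n)
    -- = 1`.
    refine (contMDiffAt_val_along hφ g (hW q) (contMDiffAt_mfderiv_apply (hs q)
      (D.vfsmoothAt_n q))).congr_of_eventuallyEq (Filter.Eventually.of_forall fun p => ?_)
    beta_reduce
    rw [hβ p, map_add, map_smul, add_apply, smul_apply, hD.ell_eq, hD.γ_eq, D.γ_n,
      (D.n_spec p).2, smul_eq_mul, mul_one, add_zero]
  refine ⟨β, Wbar, hβs, fun q => ?_, hβ⟩
  -- Since `γ` is degenerate, the tangential part is tested against `γ + ℓ ⊗ ℓ`, using `γ(Wbar,u) =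
  -- g(W,u) - β ℓ(u)` and `ℓ(Wbar) = g(W,ζ) - β ℓ⁽²⁾`.
  refine vfsmoothAt_of_dual (h := D.aux) (D.smooth_aux q) (D.aux_eq_zero q) fun u => ?_
  have hu := contMDiffAt_mfderiv_apply (hs q) (vfsmoothAt_extend_self (I := J) u)
  have h1 := contMDiffAt_val_along hφ g (hW q) hu
  have h2 := contMDiffAt_val_along hφ g (ζ.smooth q) hu
  have h3 := contMDiffAt_val_along hφ g (hW q) (ζ.smooth q)
  refine ((h1.sub ((hβs q).mul h2)).add ((h3.sub ((hβs q).mul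
    (D.smooth_ell2 q))).mul h2)).congr_of_eventuallyEq (Filter.Eventually.of_forall fun p => ?_)
  have e1 : g.val (φ p) (W p) (mfderiv J I φ p (FiberBundle.extend E' u p))
      = β p * D.ell p (FiberBundle.extend E' u p)
        + D.γ p (Wbar p) (FiberBundle.extend E' u p) := by
    rw [hβ p, map_add, map_smul, add_apply, smul_apply, hD.ell_eq, hD.γ_eq, smul_eq_mul]
  have e2 : g.val (φ p) (W p) (ζ.field p) = β p * D.ell2 p + D.ell p (Wbar p) := by
    rw [hβ p, map_add, map_smul, add_apply, smul_apply, hD.ell2_eq, g.symm _ _ (ζ.field p),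
      hD.ell_eq, smul_eq_mul]
  simp only [Pi.add_apply, Pi.mul_apply]
  rw [e1, e2, hD.ell_eq, D.aux_apply]
  ring

end Decomposition

end NullHypersurface

end

/-! ### The lemma, assembled from the rigging and tangential components. -/

theorem lemma5p1 {n : ℕ}
    {N : Type*} [TopologicalSpace N] [ChartedSpace (EuclideanSpace ℝ (Fin n)) N]
    [IsManifold (𝓡 n) ∞ N]
    {M : Type*} [TopologicalSpace M] [ChartedSpace (EuclideanSpace ℝ (Fin (n + 1))) M]
    [IsManifold (𝓡 (n + 1)) ∞ M]
    (g : LorentzianMetric (𝓡 (n + 1)) M) (D : NullHypersurfaceData (𝓡 n) N)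
    (φ : N → M) (hφ : Manifold.IsSmoothEmbedding (𝓡 n) (𝓡 (n + 1)) ∞ φ)
    (ζ : Rigging (𝓡 (n + 1)) (𝓡 n) φ) (hD : D.IsEmbedded g hφ ζ)
    (O : Set M) (hO : IsOpen O) (hφO : Set.range φ ⊆ O)
    (η : Π y : M, TangentSpace (𝓡 (n + 1)) y)
    (hη : ContMDiffOn (𝓡 (n + 1)) (𝓡 (n + 1)).tangent ∞
      (fun y => (⟨y, η y⟩ : TangentBundle (𝓡 (n + 1)) M)) O)
    (htangent : ∀ q : N, η (φ q) ∈ Set.range (mfderiv (𝓡 n) (𝓡 (n + 1)) φ q))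
    (hnull : ∀ q : N, g.val (φ q) (η (φ q)) (η (φ q)) = 0) :
    ∃ α : N → ℝ, ContMDiff (𝓡 n) 𝓘(ℝ) ∞ α ∧
      (∀ q : N, η (φ q) = α q • mfderiv (𝓡 n) (𝓡 (n + 1)) φ q (D.n q)) ∧
      (∀ W : Π q : N, TangentSpace (𝓡 (n + 1)) (φ q),
        ContMDiff (𝓡 n) (𝓡 (n + 1)).tangent ∞
          (fun q => (⟨φ q, W q⟩ : TangentBundle (𝓡 (n + 1)) M)) →
        ∃ (β : N → ℝ) (Wbar : Π q : N, TangentSpace (𝓡 n) q),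
          ContMDiff (𝓡 n) 𝓘(ℝ) ∞ β ∧
          ContMDiff (𝓡 n) (𝓡 n).tangent ∞ (fun q => (⟨q, Wbar q⟩ : TangentBundle (𝓡 n) N)) ∧
          ∀ q : N, W q = β q • ζ.field q + mfderiv (𝓡 n) (𝓡 (n + 1)) φ q (Wbar q)) ∧
      ∀ (W : Π q : N, TangentSpace (𝓡 (n + 1)) (φ q)) (β : N → ℝ)
        (Wbar : Π q : N, TangentSpace (𝓡 n) q),
        (∀ q : N, W q = β q • ζ.field q + mfderiv (𝓡 n) (𝓡 (n + 1)) φ q (Wbar q)) →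
        ∀ (q : N) (u v : TangentSpace (𝓡 n) q) (X Z : Π y : M, TangentSpace (𝓡 (n + 1)) y),
          ContMDiffAt (𝓡 (n + 1)) (𝓡 (n + 1)).tangent ∞
            (fun y => (⟨y, X y⟩ : TangentBundle (𝓡 (n + 1)) M)) (φ q) →
          ContMDiffAt (𝓡 (n + 1)) (𝓡 (n + 1)).tangent ∞
            (fun y => (⟨y, Z y⟩ : TangentBundle (𝓡 (n + 1)) M)) (φ q) →
          X (φ q) = mfderiv (𝓡 n) (𝓡 (n + 1)) φ q u →
          Z (φ q) = mfderiv (𝓡 n) (𝓡 (n + 1)) φ q v →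
          g.val (φ q) (W q) (lieDerivConnection η (leviCivita g) X Z (φ q))
            = β q * bTensor D hφ ζ g η q u v
              + (mvfderiv (𝓡 n) α q u * D.U q v (Wbar q)
                + mvfderiv (𝓡 n) α q v * D.U q u (Wbar q)
                + D.U q u v * (qCovector ζ g η q (Wbar q) - mvfderiv (𝓡 n) α q (Wbar q))
                + α q *
                  (covDeriv₂ (metricHypersurfaceConnection D.toNullMetricData) D.U q u v (Wbar q)
                  + covDeriv₂ (metricHypersurfaceConnection D.toNullMetricData) D.U q v u (Wbar q)
                  - covDeriv₂ (metricHypersurfaceConnection D.toNullMetricData) D.U q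
                      (Wbar q) u v)) := by
  have hdim : Module.finrank ℝ (EuclideanSpace ℝ (Fin (n + 1)))
      = Module.finrank ℝ (EuclideanSpace ℝ (Fin n)) + 1 := by
    simp
  have hηs : ∀ q, VFSmoothAt η (φ q) := fun q =>
    hη.contMDiffAt (hO.mem_nhds (hφO ⟨q, rfl⟩))
  obtain ⟨α, hα⟩ := exists_isNullTangent hD hηs htangent hnull
  have hL := isLeviCivita_leviCivita g
  have h₀ := isMetricHypersurfaceConnection_metricHypersurfaceConnection D.toNullMetricData
  refine ⟨α, hα.smooth_coeff, hα.eq_along,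
    fun W hW => exists_smooth_decomposition hD hdim W hW, ?_⟩
  -- The identity is pointwise and linear in `W`, so no regularity of `β` or `Wbar` is involved.
  intro W β Wbar hW q u v X Z hX hZ hXu hZv
  rw [hW q, map_add, map_smul, add_apply, smul_apply, smul_eq_mul,
    hα.val_rigging hD hdim hL u v hX hZ hXu hZv,
    hα.val_tangent hD hdim hL h₀ u v (Wbar q) hX hZ hXu hZv]
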